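/- Let $k$ be a $p$-adic field (a finite extension of some $\mathbb{Q}_p$) with ring of integers $\mathcal{O}$, residue field of size $q$ and normalized absolute value $|\ |$, and let $G$ be one of the following unramified classical groups over $k$: split $\mathrm{SO}(2n+1)$; $\mathrm{Sp}(2n)$; the quasi-split unitary group $\mathrm{U}(n)$ of the unramified quadratic extension $E/k$; split $\mathrm{SO}(2n)$; or the non-split quasi-split $\mathrm{SO}(2n)$ that splits over the unramified quadratic extension of $k$. Each is taken in its standard matrix realization, with hyperspecial maximal compact subgroup $K$ the stabilizer of the standard (self-dual, or semiregular) lattice, Borel subgroup $B=TU$ of (block) upper triangular matrices, and modulus character $\delta_B(t)=|\det(\mathrm{Ad}(t)\mid\mathrm{Lie}\,U)|$. A representation of $G(k)$ is *unramified* if it is irreducible, smooth, complex, and has a nonzero $K$-fixed vector; $I(\chi)=\mathrm{Ind}_B^G\chi$ denotes normalized induction. If $r$ is the $k$-rank of $G$ and $t_1,\dots,t_r$ (in $k^\times$, or in $E^\times$ for $\mathrm{U}(n)$) are the first $r$ diagonal entries of $t\in T(k)$, the unramified characters of $T(k)$ are $\chi_\alpha(t)=\prod_{i=1}^r\alpha_i^{\mathrm{ord}(t_i)}$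 with $\alpha\in(\mathbb{C}^\times)^r$. The same conventions apply to $\mathrm{GL}(N)$ over $F$, where $F=k$, except that $F=E$ for $\mathrm{U}(n)$. Let $N=2n,\ 2n+1,\ n,\ 2n,\ 2n$ in the five cases, and let $L(\alpha)\in\mathrm{GL}(N,\mathbb{C})$ be $\mathrm{diag}(\alpha_1,\dots,\alpha_r,1,\dots,1,\alpha_r^{-1},\dots,\alpha_1^{-1})$, multiplied, for non-split $\mathrm{SO}(2n)$, by the permutation matrix that exchanges the two middle basis vectors. (For $\mathrm{U}(n)$, $L(\alpha)=t\cdot\mathrm{Frob}(t)$ with $t=\mathrm{diag}(\alpha_1,\dots,\alpha_r,1,\dots,1)$ and $\mathrm{Frob}(t)=w\,{}^tt^{-1}w^{-1}$, $w$ anti-diagonal.) Thus $L(\alpha)$ is the image, under the standard homomorphism of L-groups, of the Satake parameter given by $\alpha$. For an unramified representation $\pi$ of $G(k)$ and a representation $\Pi$ of $\mathrm{GL}(N,F)$ we write $\Pi=\Sigma(\pi)$, and call $\Pi$ the functorial transfer of $\pi$, if $\Pi$ is unramified and there are $\alpha\in(\mathbb{C}^\times)^r$ and $\beta\in(\mathbb{C}^\times)^N$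 such that $\pi$ is a subquotient of $I(\chi_\alpha)$, $\Pi$ is a subquotient of $I(\chi_\beta)$, and $L(\alpha)$ is conjugate to $\mathrm{diag}(\beta_1,\dots,\beta_N)$ in $\mathrm{GL}(N,\mathbb{C})$. For $\sigma\in\mathrm{Aut}(\mathbb{C})$ and a representation $(\rho,V)$ let ${}^\sigma\rho$ be the representation on $V\otimes_{\mathbb{C},\sigma}\mathbb{C}$ in which the group acts on the first factor. Then for every $\sigma\in\mathrm{Aut}(\mathbb{C})$ and every unramified representation $\pi$ of $G(k)$ the representation ${}^\sigma\pi$ is unramified, and: (i) if $G=\mathrm{SO}(2n+1)$, $\mathrm{Sp}(2n)$ or $\mathrm{U}(n)$, then ${}^\sigma\Sigma(\pi)=\Sigma({}^\sigma\pi)$; that is, for every representation $\Pi$ of $\mathrm{GL}(N,F)$, $\Pi=\Sigma(\pi)$ if and only if ${}^\sigma\Pi=\Sigma({}^\sigma\pi)$; (ii) if $G=\mathrm{SO}(2n)$ (split or not), then ${}^\sigma\big(\Sigma(\pi)\otimes|\ |^{-1/2}\big)\otimes|\ |^{1/2}=\Sigma({}^\sigma\pi)$, where $\otimes|\ |^s$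 is the twist by $g\mapsto|\det g|^s$; that is, for every representation $\Pi$ of $\mathrm{GL}(2n,k)$, $\Pi=\Sigma(\pi)$ if and only if ${}^\sigma(\Pi\otimes|\ |^{-1/2})\otimes|\ |^{1/2}=\Sigma({}^\sigma\pi)$. -/

import Mathlib

open ValuativeRel

noncomputable section

namespace UnramTransfer

/-! ### Local fields: normalized valuation and absolute value -/

section LocalField

variable (F : Type*) [Field F] [ValuativeRel F] [TopologicalSpace F] [IsNonarchimedeanLocalField F]

/-- The normalized additive valuation of a non-archimedean local field: it is `0` on the units of
the ring of integers and `1` on uniformizers (with the junk value `ord 0 = 0`). -/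
def ord (x : F) : ℤ :=
  -WithZero.log (IsNonarchimedeanLocalField.valueGroupWithZeroIsoInt F (valuation F x))

/-- The normalized absolute value `|x| = q ^ (-ord x)`, with `q` the size of the residue field. -/
def normAbs (x : F) : ℝ :=
  open Classical in if x = 0 then 0 else (Nat.card 𝓀[F] : ℝ) ^ (-ord F x)

variable {F}

theorem ord_one : ord F 1 = 0 := by simp [ord]

theorem ord_mul {x y : F} (hx : x ≠ 0) (hy : y ≠ 0) : ord F (x * y) = ord F x + ord F y := by
  unfold ord
  rw [map_mul, map_mul, WithZero.log_mul (by simpa using hx) (by simpa using hy)]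
  ring

theorem normAbs_one : normAbs F 1 = 1 := by simp [normAbs, ord_one]

theorem normAbs_nonneg (x : F) : 0 ≤ normAbs F x := by
  unfold normAbs
  split_ifs <;> positivity

theorem normAbs_mul (x y : F) : normAbs F (x * y) = normAbs F x * normAbs F y := by
  by_cases hx : x = 0
  · simp [normAbs, hx]
  by_cases hy : y = 0
  · simp [normAbs, hy]
  have hq : (Nat.card 𝓀[F] : ℝ) ≠ 0 := by
    exact_mod_cast Nat.card_pos.ne'
  simp only [normAbs, hx, hy, mul_eq_zero, or_self, if_false, ord_mul hx hy]
  rw [neg_add, zpow_add₀ hq]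

end LocalField

/-! ### Complex representations -/

section Representations

/-- The complex vector space `V ⊗_{ℂ, σ} ℂ`, realized on `V` itself through
`v ⊗ c ↦ σ⁻¹(c) v`: the scalar `c` acts on it as `σ⁻¹(c)` acts on `V`. -/
def Conj (_ : ℂ ≃+* ℂ) (V : Type*) : Type _ := V

instance (σ : ℂ ≃+* ℂ) (V : Type*) [AddCommGroup V] : AddCommGroup (Conj σ V) :=
  inferInstanceAs (AddCommGroup V)

instance (σ : ℂ ≃+* ℂ) (V : Type*) [AddCommGroup V] [Module ℂ V] : Module ℂ (Conj σ V) :=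
  Module.compHom V (σ.symm : ℂ →+* ℂ)

variable {G V W : Type*} [Group G] [AddCommGroup V] [Module ℂ V] [AddCommGroup W] [Module ℂ W]

/-- The conjugate `^σ ρ`: the group acts on `V ⊗_{ℂ, σ} ℂ` through the first factor. -/
def conjRep (σ : ℂ ≃+* ℂ) (ρ : Representation ℂ G V) : Representation ℂ G (Conj σ V) where
  toFun g :=
    { toFun := fun v => ρ g (show V from v)
      map_add' := fun v w => (ρ g).map_add v w
      map_smul' := fun c v => (ρ g).map_smul (σ.symm c) v }
  map_one' := by
    ext v
    exact congrArg (fun f : V →ₗ[ℂ] V => f v) ρ.map_one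
  map_mul' g h := by
    ext v
    exact congrArg (fun f : V →ₗ[ℂ] V => f v) (ρ.map_mul g h)

/-- The twist `ρ ⊗ η` of a representation by a character. -/
def twist (η : G →* ℂ) (ρ : Representation ℂ G V) : Representation ℂ G V where
  toFun g := η g • ρ g
  map_one' := by simp
  map_mul' g h := by
    ext v
    simp [mul_smul, smul_comm (η h)]

/-- `π` is isomorphic to a subquotient of `τ`: it is a quotient of a subrepresentation of `τ`. -/
def IsSubquotient (π : Representation ℂ G V) (τ : Representation ℂ G W) : Prop :=
  ∃ (S : Subrepresentation τ) (q : S.toRepresentation.IntertwiningMap π), Function.Surjective q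

/-- Every vector has an open stabilizer. -/
def IsSmooth [TopologicalSpace G] (π : Representation ℂ G V) : Prop :=
  ∀ v, IsOpen {g : G | π g v = v}

end Representations

/-! ### Matrix groups with a Borel subgroup -/

section Group

/-- A group of invertible matrices over `R` with its Lie algebra over `k`, and a partition of the
standard basis into consecutive blocks. The block upper triangular matrices of the group will form
a Borel subgroup; `r` is the rank of its maximal split torus, on which the first `r` diagonal
entries are coordinates. -/
structure GroupDatum (k R : Type*) [Field k] [Field R] [Algebra k R] (m r : ℕ) where
  /-- the group of rational points -/
  group : Subgroup (GL (Fin m) R)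
  /-- its Lie algebra -/
  lie : Submodule k (Matrix (Fin m) (Fin m) R)
  conj_mem : ∀ g ∈ group, ∀ X ∈ lie, g.val * X * (g⁻¹).val ∈ lie
  /-- the block that contains a given basis vector -/
  block : Fin m → ℕ
  rank_le : r ≤ m

variable {k R : Type*} [Field k] [Field R] [Algebra k R] {m r : ℕ}

/-- The torus `T` of the block diagonal elements. -/
def GroupDatum.torus (D : GroupDatum k R m r) : Subgroup D.group where
  carrier := {t | ∀ i j, D.block i ≠ D.block j →
    t.val.val i j = 0 ∧ (t⁻¹).val.val i j = 0}
  one_mem' := by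
    intro i j h
    have hij : i ≠ j := fun e => h (by rw [e])
    simp [Matrix.one_apply_ne hij]
  mul_mem' := by
    intro s t hs ht i j h
    refine ⟨?_, ?_⟩
    · show (s.val.val * t.val.val) i j = 0
      rw [Matrix.mul_apply]
      refine Finset.sum_eq_zero fun l _ => ?_
      by_cases hl : D.block i = D.block l
      · rw [(ht l j (hl ▸ h)).1, mul_zero]
      · rw [(hs i l hl).1, zero_mul]
    · rw [mul_inv_rev]
      show ((t⁻¹).val.val * (s⁻¹).val.val) i j = 0
      rw [Matrix.mul_apply]
      refine Finset.sum_eq_zero fun l _ => ?_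
      by_cases hl : D.block i = D.block l
      · rw [(hs l j (hl ▸ h)).2, mul_zero]
      · rw [(ht i l hl).2, zero_mul]
  inv_mem' := by
    intro t ht i j h
    rw [inv_inv]
    exact ⟨(ht i j h).2, (ht i j h).1⟩

/-- The unipotent radical `N` of the Borel subgroup `B = T N` of block upper triangular elements. -/
def GroupDatum.unipotent (D : GroupDatum k R m r) : Set D.group :=
  {u | ∀ i j, D.block j ≤ D.block i → u.val.val i j = (1 : Matrix (Fin m) (Fin m) R) i j}

/-- The Lie algebra of `N`. -/
def GroupDatum.nilradical (D : GroupDatum k R m r) : Submodule k (Matrix (Fin m) (Fin m) R) where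
  carrier := {X | X ∈ D.lie ∧ ∀ i j, D.block j ≤ D.block i → X i j = 0}
  zero_mem' := ⟨D.lie.zero_mem, fun _ _ _ => rfl⟩
  add_mem' := fun {X Y} hX hY => ⟨D.lie.add_mem hX.1 hY.1, fun i j h => by
    rw [Matrix.add_apply, hX.2 i j h, hY.2 i j h, add_zero]⟩
  smul_mem' := fun c X hX => ⟨D.lie.smul_mem c hX.1, fun i j h => by
    rw [Matrix.smul_apply, hX.2 i j h, smul_zero]⟩

theorem GroupDatum.conj_mem_nilradical (D : GroupDatum k R m r) (t : D.torus)
    {X : Matrix (Fin m) (Fin m) R} (hX : X ∈ D.nilradical) :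
    t.val.val.val * X * ((t⁻¹).val.val.val) ∈ D.nilradical := by
  refine ⟨D.conj_mem t.val.val t.val.property X hX.1, fun i j h => ?_⟩
  rw [Matrix.mul_apply]
  refine Finset.sum_eq_zero fun l _ => ?_
  by_cases hl : D.block l = D.block j
  · have : (t.val.val.val * X) i l = 0 := by
      rw [Matrix.mul_apply]
      refine Finset.sum_eq_zero fun l' _ => ?_
      by_cases hl' : D.block i = D.block l'
      · rw [hX.2 l' l (by omega), mul_zero]
      · rw [(t.property i l' hl').1, zero_mul]
    rw [this, zero_mul]
  · rw [show ((t⁻¹).val.val.val) l j = 0 from (t.property l j hl).2, mul_zero]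

/-- The adjoint action of an element of `T` on the Lie algebra of `N`. -/
def GroupDatum.Ad (D : GroupDatum k R m r) (t : D.torus) : D.nilradical →ₗ[k] D.nilradical where
  toFun X := ⟨t.val.val.val * X.val * ((t⁻¹).val.val.val), D.conj_mem_nilradical t X.property⟩
  map_add' X Y := by
    ext1
    simp [mul_add, add_mul]
  map_smul' c X := by
    ext1
    simp

section Topological

variable [ValuativeRel k] [TopologicalSpace k] [IsNonarchimedeanLocalField k]
variable [ValuativeRel R] [TopologicalSpace R] [IsNonarchimedeanLocalField R]

/-- The modulus character `δ_B(t) = |det(Ad(t) | Lie N)|` of the Borel subgroup, on `T`. -/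
def GroupDatum.modulus (D : GroupDatum k R m r) (t : D.torus) : ℝ :=
  normAbs k (LinearMap.det (D.Ad t))

/-- The elements of the hyperspecial maximal compact subgroup: those that preserve the
standard lattice. -/
def GroupDatum.integral (D : GroupDatum k R m r) : Set D.group :=
  {g | ∀ i j, g.val.val i j ∈ 𝒪[R] ∧ (g⁻¹).val.val i j ∈ 𝒪[R]}

/-- The space of the normalized induced representation `I(χ) = Ind_B^G χ`: the functions `f` on
the group, right invariant under an open subgroup, with
`f (t u g) = χ(t) δ_B(t)^{1/2} f(g)` for `t` in `T` and `u` in `N`. -/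
def GroupDatum.indSpace (D : GroupDatum k R m r) (χ : D.torus →* ℂˣ) :
    Submodule ℂ (D.group → ℂ) where
  carrier := {f | (∃ U : Subgroup D.group, IsOpen (U : Set D.group) ∧
      ∀ g, ∀ u ∈ U, f (g * u) = f g) ∧
    ∀ t : D.torus, ∀ u ∈ D.unipotent, ∀ g,
      f (t.val * u * g) = (χ t : ℂ) * (Real.sqrt (D.modulus t) : ℂ) * f g}
  zero_mem' := ⟨⟨⊤, isOpen_univ, fun _ _ _ => rfl⟩, fun t u _ g => by simp⟩
  add_mem' := by
    rintro f f' ⟨⟨U, hU, hf⟩, h⟩ ⟨⟨U', hU', hf'⟩, h'⟩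
    refine ⟨⟨U ⊓ U', hU.inter hU', fun g u hu => ?_⟩, fun t u hu g => ?_⟩
    · simp only [Pi.add_apply]
      rw [hf g u hu.1, hf' g u hu.2]
    · simp only [Pi.add_apply]
      rw [h t u hu g, h' t u hu g, mul_add]
  smul_mem' := by
    rintro c f ⟨⟨U, hU, hf⟩, h⟩
    refine ⟨⟨U, hU, fun g u hu => ?_⟩, fun t u hu g => ?_⟩
    · simp only [Pi.smul_apply]
      rw [hf g u hu]
    · simp only [Pi.smul_apply, smul_eq_mul]
      rw [h t u hu g]
      ring

/-- The normalized induced representation `I(χ)`: the group acts by right translation. -/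
def GroupDatum.ind (D : GroupDatum k R m r) (χ : D.torus →* ℂˣ) :
    Representation ℂ D.group (D.indSpace χ) where
  toFun g :=
    { toFun := fun f => ⟨fun x => f.val (x * g), by
        obtain ⟨⟨U, hU, hf⟩, h⟩ := f.property
        refine ⟨⟨U.comap (MulAut.conj g⁻¹).toMonoidHom, ?_, fun x u hu => ?_⟩,
          fun t u hu x => ?_⟩
        · refine hU.preimage ?_
          show Continuous fun x => g⁻¹ * x * (g⁻¹)⁻¹
          fun_prop
        · have h1 := hf (x * g) (g⁻¹ * u * (g⁻¹)⁻¹) hu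
          have h2 : x * g * (g⁻¹ * u * (g⁻¹)⁻¹) = x * u * g := by group
          rw [h2] at h1
          exact h1
        · have h1 := h t u hu (x * g)
          rw [← mul_assoc] at h1
          exact h1⟩
      map_add' := fun _ _ => rfl
      map_smul' := fun _ _ => rfl }
  map_one' := by
    ext f x
    simp
  map_mul' g h := by
    ext f x
    simp [mul_assoc]

/-- Irreducible smooth representations with a nonzero vector that is fixed by the hyperspecial
maximal compact subgroup. -/
def GroupDatum.IsUnramified (D : GroupDatum k R m r) {V : Type*} [AddCommGroup V] [Module ℂ V]
    (π : Representation ℂ D.group V) : Prop :=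
  π.IsIrreducible ∧ IsSmooth π ∧ ∃ v : V, v ≠ 0 ∧ ∀ g ∈ D.integral, π g v = v

/-- The unramified representation `π` is a constituent of `I(χ)`, where `χ` is the unramified
character of `T` with parameters `α`, that is `χ(t) = ∏ᵢ αᵢ ^ ord(tᵢ)`. -/
def GroupDatum.HasSatakeParameter (D : GroupDatum k R m r) {V : Type*} [AddCommGroup V]
    [Module ℂ V] (π : Representation ℂ D.group V) (α : Fin r → ℂˣ) : Prop :=
  D.IsUnramified π ∧ ∃ χ : D.torus →* ℂˣ,
    (∀ t : D.torus, χ t = ∏ i : Fin r,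
      α i ^ ord R (t.val.val.val (Fin.castLE D.rank_le i) (Fin.castLE D.rank_le i))) ∧
    IsSubquotient π (D.ind χ)

end Topological

end Group

/-! ### The general linear group -/

section GeneralLinear

variable (F : Type*) [Field F]

/-- `GL(N)` over `F`, with the upper triangular Borel subgroup. -/
def gl (N : ℕ) : GroupDatum F F N N where
  group := ⊤
  lie := ⊤
  conj_mem := fun _ _ _ _ => Submodule.mem_top
  block := fun i => i
  rank_le := le_rfl

variable [ValuativeRel F] [TopologicalSpace F] [IsNonarchimedeanLocalField F]

/-- The character `g ↦ |det g| ^ s` of `GL(N)`. -/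
def absDet (N : ℕ) (s : ℝ) : (gl F N).group →* ℂ where
  toFun g := ((normAbs F (Matrix.det g.val.val) ^ s : ℝ) : ℂ)
  map_one' := by simp [normAbs_one]
  map_mul' g h := by
    simp [normAbs_mul, Real.mul_rpow (normAbs_nonneg _) (normAbs_nonneg _)]

end GeneralLinear

/-! ### The classical groups -/

section Classical

/-- The isometry group of the form with Gram matrix `J`, sesquilinear for `c`. -/
def isometryGroup {k R : Type*} [Field k] [Field R] [Algebra k R] {m : ℕ} (c : R ≃ₐ[k] R)
    (J : Matrix (Fin m) (Fin m) R) : Subgroup (GL (Fin m) R) where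
  carrier := {g | (g.val.map c).transpose * J * g.val = J}
  one_mem' := by
    simp [Matrix.map_one]
  mul_mem' := by
    intro g h hg hh
    have hg' : (g.val.map c).transpose * J * g.val = J := hg
    have hh' : (h.val.map c).transpose * J * h.val = J := hh
    show ((g.val * h.val).map c).transpose * J * (g.val * h.val) = J
    rw [Matrix.map_mul, Matrix.transpose_mul]
    calc _ = (h.val.map c).transpose * ((g.val.map c).transpose * J * g.val) * h.val := by
          simp only [Matrix.mul_assoc]
      _ = J := by rw [hg', hh']
  inv_mem' := by
    intro g hg
    have hg' : (g.val.map c).transpose * J * g.val = J := hg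
    show ((g⁻¹).val.map c).transpose * J * (g⁻¹).val = J
    have h1 : ((g⁻¹).val.map c).transpose * (g.val.map c).transpose = 1 := by
      rw [← Matrix.transpose_mul, ← Matrix.map_mul, Units.mul_inv]
      simp [Matrix.map_one]
    calc _ = ((g⁻¹).val.map c).transpose * ((g.val.map c).transpose * J * g.val) * (g⁻¹).val := by
          rw [hg']
      _ = (((g⁻¹).val.map c).transpose * (g.val.map c).transpose) * J *
            (g.val * (g⁻¹).val) := by
          simp only [Matrix.mul_assoc]
      _ = J := by rw [h1, Units.mul_inv, one_mul, mul_one]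

/-- The Lie algebra of the isometry group. -/
def isometryLie {k R : Type*} [Field k] [Field R] [Algebra k R] {m : ℕ} (c : R ≃ₐ[k] R)
    (J : Matrix (Fin m) (Fin m) R) : Submodule k (Matrix (Fin m) (Fin m) R) where
  carrier := {X | (X.map c).transpose * J + J * X = 0}
  zero_mem' := by
    simp [Matrix.map_zero]
  add_mem' := by
    intro X Y hX hY
    have hX' : (X.map c).transpose * J + J * X = 0 := hX
    have hY' : (Y.map c).transpose * J + J * Y = 0 := hY
    show ((X + Y).map c).transpose * J + J * (X + Y) = 0
    rw [Matrix.map_add _ (map_add c), Matrix.transpose_add, add_mul, mul_add]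
    calc _ = ((X.map c).transpose * J + J * X) + ((Y.map c).transpose * J + J * Y) := by abel
      _ = 0 := by rw [hX', hY', add_zero]
  smul_mem' := by
    intro a X hX
    have hX' : (X.map c).transpose * J + J * X = 0 := hX
    show ((a • X).map c).transpose * J + J * (a • X) = 0
    have h1 : (a • X).map c = a • X.map c := by
      ext i j
      simp
    rw [h1, Matrix.transpose_smul, Matrix.smul_mul, Matrix.mul_smul, ← smul_add, hX', smul_zero]

theorem isometryLie_conj_mem {k R : Type*} [Field k] [Field R] [Algebra k R] {m : ℕ}
    (c : R ≃ₐ[k] R) (J : Matrix (Fin m) (Fin m) R) (g : GL (Fin m) R) (hg : g ∈ isometryGroup c J)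
    (X : Matrix (Fin m) (Fin m) R) (hX : X ∈ isometryLie c J) :
    g.val * X * (g⁻¹).val ∈ isometryLie c J := by
  have hX' : (X.map c).transpose * J + J * X = 0 := hX
  have hg1 : (g.val.map c).transpose * J * g.val = J := hg
  have hg2 : ((g⁻¹).val.map c).transpose * J * (g⁻¹).val = J := (isometryGroup c J).inv_mem hg
  have e1 : (g.val.map c).transpose * J = J * (g⁻¹).val := by
    calc _ = (g.val.map c).transpose * J * (g.val * (g⁻¹).val) := by rw [Units.mul_inv, mul_one]
      _ = ((g.val.map c).transpose * J * g.val) * (g⁻¹).val := by simp only [Matrix.mul_assoc]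
      _ = _ := by rw [hg1]
  have e2 : J * g.val = ((g⁻¹).val.map c).transpose * J := by
    calc _ = (((g⁻¹).val.map c).transpose * J * (g⁻¹).val) * g.val := by rw [hg2]
      _ = ((g⁻¹).val.map c).transpose * J * ((g⁻¹).val * g.val) := by
        simp only [Matrix.mul_assoc]
      _ = _ := by rw [Units.inv_mul, mul_one]
  show ((g.val * X * (g⁻¹).val).map c).transpose * J + J * (g.val * X * (g⁻¹).val) = 0
  rw [Matrix.map_mul, Matrix.map_mul, Matrix.transpose_mul, Matrix.transpose_mul]
  calc _ = ((g⁻¹).val.map c).transpose * ((X.map c).transpose * ((g.val.map c).transpose * J)) +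
        (J * g.val) * X * (g⁻¹).val := by simp only [Matrix.mul_assoc]
    _ = ((g⁻¹).val.map c).transpose * ((X.map c).transpose * J + J * X) * (g⁻¹).val := by
        rw [e1, e2, Matrix.mul_add, Matrix.add_mul]
        simp only [Matrix.mul_assoc]
    _ = 0 := by rw [hX', mul_zero, zero_mul]

/-- The matrices of determinant one. -/
def detOne (R : Type*) [Field R] (m : ℕ) : Subgroup (GL (Fin m) R) :=
  (Matrix.GeneralLinearGroup.det : GL (Fin m) R →* Rˣ).ker

/-- Gram matrix of the polar form of `∑_{i<n} xᵢ x_{2n-i} + xₙ²` (indices from `0` to `2n`). -/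
def gramOdd (k : Type*) [Field k] (n : ℕ) : Matrix (Fin (2 * n + 1)) (Fin (2 * n + 1)) k :=
  fun i j => if j = i.rev then (if (i : ℕ) = n then 2 else 1) else 0

/-- Gram matrix of an alternating form of dimension `2n`. -/
def gramSymplectic (k : Type*) [Field k] (n : ℕ) : Matrix (Fin (2 * n)) (Fin (2 * n)) k :=
  fun i j => if j = i.rev then (if (i : ℕ) < n then 1 else -1) else 0

/-- The anti-diagonal matrix with entries `1`: the split Hermitian form, and the polar form of the
split quadratic form `∑_{i<n} xᵢ x_{2n-1-i}` if `m = 2n`. -/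
def gramSplit (R : Type*) [Field R] (m : ℕ) : Matrix (Fin m) (Fin m) R :=
  fun i j => if j = i.rev then 1 else 0

/-- Gram matrix of the polar form of
`∑_{i<n-1} xᵢ x_{2n-1-i} + (x_{n-1}² + a x_{n-1} x_n + b x_n²)` (indices from `0` to `2n-1`). -/
def gramNonsplit (k : Type*) [Field k] (n : ℕ) (a b : k) : Matrix (Fin (2 * n)) (Fin (2 * n)) k :=
  fun i j =>
    if (i : ℕ) + 1 = n ∧ j = i then 2
    else if (i : ℕ) = n ∧ j = i then 2 * b
    else if j = i.rev then (if (i : ℕ) + 1 = n ∨ (i : ℕ) = n then a else 1)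
    else 0

/-- Split `SO(2n+1)`. -/
def soOdd (k : Type*) [Field k] (n : ℕ) : GroupDatum k k (2 * n + 1) n where
  group := isometryGroup (AlgEquiv.refl : k ≃ₐ[k] k) (gramOdd k n) ⊓ detOne k (2 * n + 1)
  lie := isometryLie (AlgEquiv.refl : k ≃ₐ[k] k) (gramOdd k n)
  conj_mem := fun g hg => isometryLie_conj_mem _ _ g hg.1
  block := fun i => i
  rank_le := by omega

/-- `Sp(2n)`. -/
def sp (k : Type*) [Field k] (n : ℕ) : GroupDatum k k (2 * n) n where
  group := isometryGroup (AlgEquiv.refl : k ≃ₐ[k] k) (gramSymplectic k n)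
  lie := isometryLie (AlgEquiv.refl : k ≃ₐ[k] k) (gramSymplectic k n)
  conj_mem := isometryLie_conj_mem _ _
  block := fun i => i
  rank_le := by omega

/-- The quasi-split unitary group `U(n)` of an extension `R / k` with conjugation `c`. -/
def unitaryU {k R : Type*} [Field k] [Field R] [Algebra k R] (c : R ≃ₐ[k] R) (n : ℕ) :
    GroupDatum k R n (n / 2) where
  group := isometryGroup c (gramSplit R n)
  lie := isometryLie c (gramSplit R n)
  conj_mem := isometryLie_conj_mem _ _
  block := fun i => i
  rank_le := Nat.div_le_self n 2

/-- Split `SO(2n)`. -/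
def soEvenSplit (k : Type*) [Field k] (n : ℕ) : GroupDatum k k (2 * n) n where
  group := isometryGroup (AlgEquiv.refl : k ≃ₐ[k] k) (gramSplit k (2 * n)) ⊓ detOne k (2 * n)
  lie := isometryLie (AlgEquiv.refl : k ≃ₐ[k] k) (gramSplit k (2 * n))
  conj_mem := fun g hg => isometryLie_conj_mem _ _ g hg.1
  block := fun i => i
  rank_le := by omega

/-- The quasi-split group `SO(2n)` whose anisotropic kernel is the special orthogonal group of the
binary form `x² + a x y + b y²`; its two middle basis vectors form one block. -/
def soEvenNonsplit (k : Type*) [Field k] (n : ℕ) (a b : k) : GroupDatum k k (2 * n) (n - 1) where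
  group := isometryGroup (AlgEquiv.refl : k ≃ₐ[k] k) (gramNonsplit k n a b) ⊓ detOne k (2 * n)
  lie := isometryLie (AlgEquiv.refl : k ≃ₐ[k] k) (gramNonsplit k n a b)
  conj_mem := fun g hg => isometryLie_conj_mem _ _ g hg.1
  block := fun i => if (i : ℕ) = n then n - 1 else i
  rank_le := by omega

end Classical

/-! ### Functorial transfer -/

section Transfer

/-- `diag(α₁, …, α_r, 1, …, 1, α_r⁻¹, …, α₁⁻¹)` of size `N`. -/
def dualTorus {r : ℕ} (N : ℕ) (α : Fin r → ℂˣ) : Matrix (Fin N) (Fin N) ℂ :=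
  Matrix.diagonal fun i =>
    if h : (i : ℕ) < r then (α ⟨i, h⟩ : ℂ)
    else if h' : (i.rev : ℕ) < r then ((α ⟨i.rev, h'⟩)⁻¹ : ℂˣ) else 1

/-- The element of `O(2n, ℂ)` that exchanges the two middle basis vectors: the image of Frobenius
under the standard representation of the L-group of a nonsplit `SO(2n)`. -/
def frobeniusSwap (n : ℕ) : Matrix (Fin (2 * n)) (Fin (2 * n)) ℂ :=
  fun i j =>
    if (i : ℕ) + 1 = n ∨ (i : ℕ) = n then (if j = i.rev then 1 else 0)
    else (if j = i then 1 else 0)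

/-- The matrix `diag(α₁, …, α_r, 1, …, 1)` of size `n`, an element of the dual group of `U(n)`. -/
def halfTorus {r : ℕ} (n : ℕ) (α : Fin r → ℂˣ) : Matrix (Fin n) (Fin n) ℂ :=
  Matrix.diagonal fun i => if h : (i : ℕ) < r then (α ⟨i, h⟩ : ℂ) else 1

/-- The action `t ↦ w ᵗt⁻¹ w⁻¹` of the Frobenius of `k` on the diagonal torus of the dual group
`GL(n, ℂ)` of `U(n)`; here `w` is anti-diagonal with entries `±1`, whose signs do not affect the
action on diagonal matrices. -/
def unitaryFrobenius (n : ℕ) (t : Matrix (Fin n) (Fin n) ℂ) : Matrix (Fin n) (Fin n) ℂ :=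
  gramSplit ℂ n * (t⁻¹).transpose * (gramSplit ℂ n)⁻¹

variable {k R : Type*} [Field k] [ValuativeRel k] [TopologicalSpace k]
  [IsNonarchimedeanLocalField k] [Field R] [ValuativeRel R] [TopologicalSpace R]
  [IsNonarchimedeanLocalField R] [Algebra k R] {m r : ℕ}

/-- Functorial transfer of unramified representations to `GL(N, R)` along a homomorphism of
L-groups which maps the Satake parameter `α` to the element `L α` of `GL(N, ℂ)`: the Satake
parameter of `Π` is the conjugacy class of `L α`, for a Satake parameter `α` of `π`. -/
def IsTransfer (D : GroupDatum k R m r) {N : ℕ} (L : (Fin r → ℂˣ) → Matrix (Fin N) (Fin N) ℂ)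
    {V W : Type*} [AddCommGroup V] [Module ℂ V] [AddCommGroup W] [Module ℂ W]
    (π : Representation ℂ D.group V) (Pi : Representation ℂ (gl R N).group W) : Prop :=
  ∃ (α : Fin r → ℂˣ) (β : Fin N → ℂˣ),
    D.HasSatakeParameter π α ∧ (gl R N).HasSatakeParameter Pi β ∧
    ∃ P : GL (Fin N) ℂ, P.val * L α * (P⁻¹).val = Matrix.diagonal fun i => (β i : ℂ)

/-- Dual group `Sp(2n, ℂ)`. -/
def transferSOOdd (k : Type*) [Field k] [ValuativeRel k] [TopologicalSpace k]
    [IsNonarchimedeanLocalField k] (n : ℕ) {V W : Type*} [AddCommGroup V] [Module ℂ V]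
    [AddCommGroup W] [Module ℂ W] (π : Representation ℂ (soOdd k n).group V)
    (Pi : Representation ℂ (gl k (2 * n)).group W) : Prop :=
  IsTransfer (soOdd k n) (dualTorus (2 * n)) π Pi

/-- Dual group `SO(2n+1, ℂ)`. -/
def transferSp (k : Type*) [Field k] [ValuativeRel k] [TopologicalSpace k]
    [IsNonarchimedeanLocalField k] (n : ℕ) {V W : Type*} [AddCommGroup V] [Module ℂ V]
    [AddCommGroup W] [Module ℂ W] (π : Representation ℂ (sp k n).group V)
    (Pi : Representation ℂ (gl k (2 * n + 1)).group W) : Prop :=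
  IsTransfer (sp k n) (dualTorus (2 * n + 1)) π Pi

/-- Standard base change to `GL(n)` over the quadratic extension `R`: the Frobenius of `R` is the
square of the Frobenius of `k`, so that the Satake parameter `t ⋊ Frob` is sent to
`t · Frob(t)`. -/
def transferUnitary (c : R ≃ₐ[k] R) (n : ℕ) {V W : Type*} [AddCommGroup V] [Module ℂ V]
    [AddCommGroup W] [Module ℂ W] (π : Representation ℂ (unitaryU c n).group V)
    (Pi : Representation ℂ (gl R n).group W) : Prop :=
  IsTransfer (unitaryU c n) (fun α => halfTorus n α * unitaryFrobenius n (halfTorus n α)) π Pi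

/-- Dual group `SO(2n, ℂ)`. -/
def transferSOEvenSplit (k : Type*) [Field k] [ValuativeRel k] [TopologicalSpace k]
    [IsNonarchimedeanLocalField k] (n : ℕ) {V W : Type*} [AddCommGroup V] [Module ℂ V]
    [AddCommGroup W] [Module ℂ W] (π : Representation ℂ (soEvenSplit k n).group V)
    (Pi : Representation ℂ (gl k (2 * n)).group W) : Prop :=
  IsTransfer (soEvenSplit k n) (dualTorus (2 * n)) π Pi

/-- Dual group `SO(2n, ℂ)`, on which Frobenius acts through an element of `O(2n, ℂ)`. -/
def transferSOEvenNonsplit (k : Type*) [Field k] [ValuativeRel k] [TopologicalSpace k]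
    [IsNonarchimedeanLocalField k] (n : ℕ) (a b : k) {V W : Type*} [AddCommGroup V] [Module ℂ V]
    [AddCommGroup W] [Module ℂ W] (π : Representation ℂ (soEvenNonsplit k n a b).group V)
    (Pi : Representation ℂ (gl k (2 * n)).group W) : Prop :=
  IsTransfer (soEvenNonsplit k n a b) (fun α => dualTorus (2 * n) α * frobeniusSwap n) π Pi

end Transfer

end UnramTransfer

end

open UnramTransfer

/-!
An automorphism `σ` of `ℂ` multiplies `√q` by a sign `s`, hence it multiplies the value of the
square root of the modulus character at `t` by `s ^ ord (det (Ad t))`. Therefore conjugation by `σ`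
carries `I(χ_α)` to `I(χ_{ε σ(α)})`, as soon as this sign character of the torus is the unramified
one with all parameters equal to `ε`; for `GL(N)` it is so up to a power of `s ^ ord (det g)`, a
character of the whole group which twists the representation. The theorem compares these signs for
`G` and for `GL(N)`: `L(ε σ(α)) = ε' σ(L(α))`.

The parity of `ord (det (Ad t))` is computed on the columns of the elements of the nilradical. An
element `X` is determined by the entries of its columns `i.rev`, for `i < r`, in the rows from `i`
to `i.rev - 1`. The entries in the rows other than `i` are free and `X i i.rev` is subject to one
linear condition, which depends on the form, so that `det (Ad t)` is a product over `i`.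
-/

noncomputable section

namespace UnramTransfer

section TwistedEquiv

attribute [local instance] RingHomInvPair.of_ringEquiv RingHomInvPair.of_ringEquiv_symm

variable {G V V' W W' : Type*} [Group G] [AddCommGroup V] [Module ℂ V] [AddCommGroup V']
  [Module ℂ V'] [AddCommGroup W] [Module ℂ W] [AddCommGroup W'] [Module ℂ W']

/-- A `σ`-semilinear equivalence of `V` with `V'` that identifies `ρ` with `η ⊗ ρ'`, where `η` is
a character with values `±1`. -/
structure TwistedEquiv (σ : ℂ ≃+* ℂ) (η : G →* ℤˣ) (ρ : Representation ℂ G V)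
    (ρ' : Representation ℂ G V') extends V ≃ₛₗ[(σ : ℂ →+* ℂ)] V' where
  map_rep : ∀ g v, toLinearEquiv (ρ g v) = η g • ρ' g (toLinearEquiv v)

namespace TwistedEquiv

variable {σ : ℂ ≃+* ℂ} {η : G →* ℤˣ} {ρ : Representation ℂ G V} {ρ' : Representation ℂ G V'}
  {τ : Representation ℂ G W} {τ' : Representation ℂ G W'}

theorem rep_apply (e : TwistedEquiv σ η ρ ρ') (g : G) (v : V) :
    ρ' g (e.toLinearEquiv v) = η g • e.toLinearEquiv (ρ g v) := by
  rw [e.map_rep, smul_smul, Int.units_mul_self, one_smul]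

theorem symm_rep (e : TwistedEquiv σ η ρ ρ') (g : G) (v : V') :
    e.toLinearEquiv.symm (ρ' g v) = η g • ρ g (e.toLinearEquiv.symm v) := by
  obtain ⟨v, rfl⟩ := e.toLinearEquiv.surjective v
  rw [e.rep_apply, LinearEquiv.symm_apply_apply, Units.smul_def, map_zsmul,
    LinearEquiv.symm_apply_apply, ← Units.smul_def]

/-- The inverse equivalence. -/
def symm (e : TwistedEquiv σ η ρ ρ') : TwistedEquiv σ.symm η ρ' ρ where
  toLinearEquiv := e.toLinearEquiv.symm
  map_rep := e.symm_rep

/-- The preimage of a subrepresentation. -/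
def comap (e : TwistedEquiv σ η ρ ρ') (S : Subrepresentation ρ') : Subrepresentation ρ where
  toSubmodule := S.toSubmodule.comap (e.toLinearEquiv : V →ₛₗ[(σ : ℂ →+* ℂ)] V')
  apply_mem_toSubmodule g v hv := by
    rw [Submodule.mem_comap, LinearEquiv.coe_coe, e.map_rep]
    exact S.toSubmodule.toAddSubgroup.zsmul_mem (S.apply_mem_toSubmodule g hv) _

/-- The isomorphism of the lattices of subrepresentations given by the preimage. -/
def comapOrderIso (e : TwistedEquiv σ η ρ ρ') :
    Subrepresentation ρ' ≃o Subrepresentation ρ where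
  toFun := e.comap
  invFun := e.symm.comap
  left_inv S := by
    ext v
    exact iff_of_eq (congrArg (· ∈ S.toSubmodule) (e.toLinearEquiv.apply_symm_apply v))
  right_inv S := by
    ext v
    exact iff_of_eq (congrArg (· ∈ S.toSubmodule) (e.toLinearEquiv.symm_apply_apply v))
  map_rel_iff' := Submodule.comap_le_comap_iff_of_surjective e.toLinearEquiv.surjective

theorem isIrreducible (e : TwistedEquiv σ η ρ ρ') (h : ρ.IsIrreducible) : ρ'.IsIrreducible :=
  e.comapOrderIso.isSimpleOrder_iff.mpr h

theorem isSubquotient (e : TwistedEquiv σ η ρ ρ') (f : TwistedEquiv σ η τ τ')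
    (h : IsSubquotient ρ τ) : IsSubquotient ρ' τ' := by
  obtain ⟨S, q, hq⟩ := h
  let f' : (f.symm.comap S).toSubmodule →ₛₗ[(σ.symm : ℂ →+* ℂ)] S.toSubmodule :=
    f.toLinearEquiv.symm.toLinearMap.restrict fun _ hv => hv
  have f'_rep (g : G) (w : (f.symm.comap S).toSubmodule) :
      f' ((f.symm.comap S).toRepresentation g w) = (η g : ℤ) • S.toRepresentation g (f' w) :=
    Subtype.ext (f.symm_rep g w)
  have surjective_f' : Function.Surjective f' := fun s =>
    have hs : f.toLinearEquiv.symm (f.toLinearEquiv s) = s := f.toLinearEquiv.symm_apply_apply _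
    ⟨⟨f.toLinearEquiv s, Submodule.mem_comap.mpr (Set.mem_of_eq_of_mem hs s.property)⟩,
      Subtype.ext hs⟩
  refine ⟨f.symm.comap S,
    { toLinearMap := e.toLinearEquiv.toLinearMap ∘ₛₗ q.toLinearMap ∘ₛₗ f'
      isIntertwining' := fun g => LinearMap.ext fun w => ?_ },
    e.toLinearEquiv.surjective.comp (hq.comp surjective_f')⟩
  change e.toLinearEquiv (q (f' _)) = ρ' g (e.toLinearEquiv (q (f' w)))
  rw [f'_rep, map_zsmul, map_zsmul, q.isIntertwining, e.rep_apply, Units.smul_def]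

theorem isSmooth [TopologicalSpace G] [IsTopologicalGroup G] (e : TwistedEquiv σ η ρ ρ')
    (hη : IsOpen {g | η g = 1}) (h : IsSmooth ρ) : IsSmooth ρ' := by
  intro v
  obtain ⟨v, rfl⟩ := e.toLinearEquiv.surjective v
  let S : Subgroup G :=
    (MulAction.stabilizer (Module.End ℂ V')ˣ (e.toLinearEquiv v)).comap ρ'.toHomUnits
  refine S.isOpen_of_mem_nhds (g := 1) (Filter.mem_of_superset
    (((h v).inter hη).mem_nhds ⟨by simp, by simp⟩) ?_)
  rintro g ⟨hg : ρ g v = v, hg' : η g = 1⟩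
  change ρ' g _ = _
  rw [e.rep_apply, hg, hg', one_smul]

/-- The identity of `V`, as an equivalence of `ρ` with its conjugate. -/
def conj (σ : ℂ ≃+* ℂ) (ρ : Representation ℂ G V) : TwistedEquiv σ 1 ρ (conjRep σ ρ) where
  toLinearEquiv :=
    { AddEquiv.refl V with
      map_smul' c v := congrArg (· • v) (σ.symm_apply_apply c).symm }
  map_rep _ _ := (one_smul ℤˣ _).symm

end TwistedEquiv

end TwistedEquiv

section Ord

variable {F : Type*} [Field F] [ValuativeRel F] [TopologicalSpace F] [IsNonarchimedeanLocalField F]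

theorem ord_zero : ord F 0 = 0 := by simp [ord]

theorem ord_eq_zero_of_mul_eq_one {x y : F} (hx : x ∈ 𝒪[F]) (hy : y ∈ 𝒪[F]) (h : x * y = 1) :
    ord F x = 0 := by
  have hx1 : valuation F x = 1 := le_antisymm hx <| by
    calc 1 = valuation F x * valuation F y := by rw [← map_mul, h, map_one]
      _ ≤ valuation F x := mul_le_of_le_one_right' hy
  simp [ord, hx1]

theorem normAbs_of_ne_zero {x : F} (hx : x ≠ 0) :
    normAbs F x = (Nat.card 𝓀[F] : ℝ) ^ (-ord F x) :=
  if_neg hx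

theorem normAbs_pos {x : F} (hx : x ≠ 0) : 0 < normAbs F x := by
  rw [normAbs_of_ne_zero hx]
  exact zpow_pos (Nat.cast_pos.mpr Nat.card_pos) _

variable (F) in
/-- The elements of even valuation, together with `0`: working modulo this submonoid replaces
congruences modulo `2` between sums of valuations. -/
def evenOrd : Submonoid F where
  carrier := {x | Even (ord F x)}
  one_mem' := by simp [ord_one]
  mul_mem' {x y} hx hy := by
    rcases eq_or_ne x 0 with rfl | hx0
    · simp [ord_zero]
    rcases eq_or_ne y 0 with rfl | hy0
    · simp [ord_zero]
    rw [Set.mem_ofPred_eq, ord_mul hx0 hy0]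
    exact hx.add hy

theorem mem_evenOrd {x : F} : x ∈ evenOrd F ↔ Even (ord F x) := Iff.rfl

theorem sq_mem_evenOrd (x : F) : x ^ 2 ∈ evenOrd F := by
  rcases eq_or_ne x 0 with rfl | hx
  · simp [mem_evenOrd, ord_zero]
  · rw [sq, mem_evenOrd, ord_mul hx hx]
    exact ⟨_, rfl⟩

end Ord

section Sign

theorem sign_zpow_of_even (ε : ℤˣ) {a : ℤ} (h : Even a) : ε ^ a = 1 := by
  obtain ⟨b, rfl⟩ := h
  rw [zpow_add, Int.units_mul_self]

/-- The inclusion of the group `{±1}` in `ℂˣ`. -/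
def complexSign : ℤˣ →* ℂˣ := Units.map (Int.castRingHom ℂ : ℤ →* ℂ)

theorem sign_smul (ε : ℤˣ) (z : ℂ) : ε • z = complexSign ε * z :=
  zsmul_eq_mul z (ε : ℤ)

open Classical in
/-- The sign by which `σ` acts on the real square root of `q`. -/
def sqrtSign (σ : ℂ ≃+* ℂ) (q : ℕ) : ℤˣ :=
  if σ (√(q : ℝ) : ℂ) = (√(q : ℝ) : ℂ) then 1 else -1

theorem sqrtSign_symm (σ : ℂ ≃+* ℂ) (q : ℕ) : sqrtSign σ.symm q = sqrtSign σ q := by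
  simp only [sqrtSign, RingEquiv.symm_apply_eq, eq_comm (b := σ _)]

theorem sqrtSign_sq (σ : ℂ ≃+* ℂ) (q : ℕ) : sqrtSign σ (q ^ 2) = 1 := by
  simp [sqrtSign]

theorem map_sqrt (σ : ℂ ≃+* ℂ) (q : ℕ) :
    σ (√(q : ℝ) : ℂ) = sqrtSign σ q • (√(q : ℝ) : ℂ) := by
  have sq_sqrt : (√(q : ℝ) : ℂ) ^ 2 = q := by
    rw [← Complex.ofReal_pow, Real.sq_sqrt (Nat.cast_nonneg q), Complex.ofReal_natCast]
  have sq_map : σ (√(q : ℝ) : ℂ) ^ 2 = (√(q : ℝ) : ℂ) ^ 2 := by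
    rw [← map_pow, sq_sqrt, map_natCast]
  rw [sqrtSign]
  split_ifs with h
  · rw [one_smul, h]
  · simpa [Units.smul_def] using (sq_eq_sq_iff_eq_or_eq_neg.mp sq_map).resolve_left h

theorem map_sqrt_zpow (σ : ℂ ≃+* ℂ) (q : ℕ) (a : ℤ) :
    σ (√((q : ℝ) ^ (-a)) : ℂ) = sqrtSign σ q ^ a • (√((q : ℝ) ^ (-a)) : ℂ) := by
  have sqrt_zpow : √((q : ℝ) ^ (-a)) = √(q : ℝ) ^ (-a) := by
    rw [Real.sqrt_eq_iff_mul_self_eq (by positivity) (by positivity), ← mul_zpow,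
      Real.mul_self_sqrt (by positivity)]
  have sign_zpow : sqrtSign σ q ^ a = sqrtSign σ q ^ (-a) := by
    rw [zpow_neg, Int.units_inv_eq_self]
  rw [sqrt_zpow, Complex.ofReal_zpow, map_zpow₀, map_sqrt, sign_zpow, sign_smul, sign_smul,
    mul_zpow, map_zpow, Units.val_zpow_eq_zpow_val]

variable {F : Type*} [Field F] [ValuativeRel F] [TopologicalSpace F] [IsNonarchimedeanLocalField F]

theorem map_sqrt_normAbs (σ : ℂ ≃+* ℂ) {x : F} (hx : x ≠ 0) :
    σ (√(normAbs F x) : ℂ) = sqrtSign σ (Nat.card 𝓀[F]) ^ ord F x • (√(normAbs F x) : ℂ) := by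
  rw [normAbs_of_ne_zero hx, map_sqrt_zpow]

theorem sign_zpow_ord_of_mem_evenOrd (ε : ℤˣ) {x : F} (hx : x ∈ evenOrd F) : ε ^ ord F x = 1 :=
  sign_zpow_of_even ε hx

theorem sign_zpow_ord_congr (ε : ℤˣ) {x y : F} (hx : x ≠ 0) (hy : y ≠ 0)
    (h : x * y ∈ evenOrd F) : ε ^ ord F x = ε ^ ord F y := by
  rw [mem_evenOrd, ord_mul hx hy] at h
  rw [← mul_left_inj (ε ^ ord F y), ← zpow_add, sign_zpow_of_even ε h, Int.units_mul_self]

end Sign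

section Unramified

variable {k R : Type*} [Field k] [Field R] [Algebra k R] {m r : ℕ}
  [ValuativeRel R] [TopologicalSpace R] [IsNonarchimedeanLocalField R]
  {V V' : Type*} [AddCommGroup V] [Module ℂ V] [AddCommGroup V'] [Module ℂ V']

theorem GroupDatum.IsUnramified.of_twistedEquiv {D : GroupDatum k R m r} {σ : ℂ ≃+* ℂ}
    {η : D.group →* ℤˣ} {π : Representation ℂ D.group V} {π' : Representation ℂ D.group V'}
    (e : TwistedEquiv σ η π π') (hη : IsOpen {g | η g = 1}) (hint : ∀ g ∈ D.integral, η g = 1)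
    (h : D.IsUnramified π) : D.IsUnramified π' := by
  obtain ⟨irreducible, smooth, v, hv, fixed⟩ := h
  refine ⟨e.isIrreducible irreducible, e.isSmooth hη smooth, e.toLinearEquiv v,
    e.toLinearEquiv.map_ne_zero_iff.mpr hv, fun g hg => ?_⟩
  rw [e.rep_apply, hint g hg, fixed g hg, one_smul]

theorem GroupDatum.IsUnramified.conjRep {D : GroupDatum k R m r} (σ : ℂ ≃+* ℂ)
    {π : Representation ℂ D.group V} (h : D.IsUnramified π) : D.IsUnramified (conjRep σ π) :=
  h.of_twistedEquiv (TwistedEquiv.conj σ π) (by simp) fun _ _ => rfl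

end Unramified

section Satake

variable {k R : Type*} [Field k] [Field R] [Algebra k R] {m r : ℕ}

/-- The basis vector `i` forms a block of size one. -/
def GroupDatum.IsSingletonBlock (D : GroupDatum k R m r) (i : Fin m) : Prop :=
  ∀ j, D.block j = D.block i → j = i

/-- The diagonal entry of an element of the torus at a block of size one, as a character. -/
def GroupDatum.torusEntry (D : GroupDatum k R m r) {i : Fin m} (hi : D.IsSingletonBlock i) :
    D.torus →* Rˣ :=
  MonoidHom.toHomUnits
    { toFun t := t.val.val.val i i
      map_one' := Matrix.one_apply_eq i
      map_mul' s t := by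
        change (s.val.val.val * t.val.val.val) i i = _
        rw [Matrix.mul_apply]
        refine Finset.sum_eq_single i (fun l _ hl => ?_) (by simp)
        rw [(s.property i l fun h => hl (hi l h.symm)).1, zero_mul] }

theorem GroupDatum.torusEntry_apply (D : GroupDatum k R m r) {i : Fin m}
    (hi : D.IsSingletonBlock i) (t : D.torus) :
    (D.torusEntry hi t : R) = t.val.val.val i i := rfl

/-- The basis vector at which the `i`-th coordinate of the torus is read off. -/
abbrev GroupDatum.coordIndex (D : GroupDatum k R m r) (i : Fin r) : Fin m :=
  Fin.castLE D.rank_le i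

/-- The basis vectors that carry the coordinates of the torus form blocks of size one. -/
def GroupDatum.HasSingletonBlocks (D : GroupDatum k R m r) : Prop :=
  ∀ i, D.IsSingletonBlock (D.coordIndex i)

/-- The product of the first `r` diagonal entries of an element of the torus. -/
def GroupDatum.torusProd (D : GroupDatum k R m r) (hD : D.HasSingletonBlocks) : D.torus →* Rˣ :=
  ∏ i, D.torusEntry (hD i)

theorem GroupDatum.torusProd_apply (D : GroupDatum k R m r) (hD : D.HasSingletonBlocks)
    (t : D.torus) : D.torusProd hD t = ∏ i, D.torusEntry (hD i) t :=
  MonoidHom.finsetProd_apply _ _ _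

theorem GroupDatum.det_Ad_ne_zero (D : GroupDatum k R m r) (t : D.torus) :
    LinearMap.det (D.Ad t) ≠ 0 := by
  have h : D.Ad t ∘ₗ D.Ad t⁻¹ = LinearMap.id := by
    ext1 X
    apply Subtype.ext
    change t.val.val.val * ((t⁻¹).val.val.val * X.val * ((t⁻¹)⁻¹).val.val.val) *
      (t⁻¹).val.val.val = X.val
    have mul_inv : t.val.val.val * (t⁻¹).val.val.val = 1 := t.val.val.mul_inv
    rw [inv_inv, ← mul_assoc, ← mul_assoc, mul_inv, one_mul, mul_assoc, mul_inv, mul_one]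
  rw [← isUnit_iff_ne_zero]
  exact .of_mul_eq_one _ (by rw [← LinearMap.det_comp, h, LinearMap.det_id])

variable [TopologicalSpace R] [ValuativeRel k] [TopologicalSpace k] [IsNonarchimedeanLocalField k]

theorem GroupDatum.mem_indSpace_of_map {D : GroupDatum k R m r} {σ : ℂ ≃+* ℂ}
    {η : D.group →* ℤˣ} (hη : IsOpen {g | η g = 1}) (hu : ∀ u ∈ D.unipotent, η u = 1)
    {χ χ' : D.torus →* ℂˣ}
    (h : ∀ t : D.torus, σ (χ t * (√(D.modulus t) : ℂ)) =
      η t.val • (χ' t * (√(D.modulus t) : ℂ)))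
    {f : D.group → ℂ} (hf : f ∈ D.indSpace χ) : (fun g => η g • σ (f g)) ∈ D.indSpace χ' := by
  obtain ⟨⟨U, hU, hfU⟩, hfB⟩ := hf
  refine ⟨⟨U ⊓ η.ker, hU.inter hη, fun g u hgu => ?_⟩, fun t u hgu g => ?_⟩
  · dsimp only
    rw [hfU g u hgu.1, map_mul η, show η u = 1 from hgu.2, mul_one]
  · dsimp only
    rw [hfB t u hgu g, map_mul σ, h t, map_mul, map_mul, hu u hgu, mul_one, smul_mul_assoc,
      smul_smul, mul_right_comm, Int.units_mul_self, one_mul, mul_smul_comm]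

variable [ValuativeRel R] [IsNonarchimedeanLocalField R]

variable (R) in
/-- The unramified character of `Rˣ` with values `±1` that takes the value `ε` on uniformizers. -/
def unramifiedSign (ε : ℤˣ) : Rˣ →* ℤˣ where
  toFun x := ε ^ ord R x
  map_one' := by rw [Units.val_one, ord_one, zpow_zero]
  map_mul' x y := by rw [Units.val_mul, ord_mul x.ne_zero y.ne_zero, zpow_add]

theorem unramifiedSign_apply (ε : ℤˣ) (x : Rˣ) : unramifiedSign R ε x = ε ^ ord R x := rfl

theorem unramifiedSign_one : unramifiedSign R 1 = 1 :=
  MonoidHom.ext fun _ => one_zpow _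

/-- Conjugation by `σ` and multiplication by `η` identify two principal series. -/
def GroupDatum.indEquiv (D : GroupDatum k R m r) (σ : ℂ ≃+* ℂ) (η : D.group →* ℤˣ)
    (hη : IsOpen {g | η g = 1}) (hu : ∀ u ∈ D.unipotent, η u = 1) (χ χ' : D.torus →* ℂˣ)
    (h : ∀ t : D.torus, σ (χ t * (√(D.modulus t) : ℂ)) =
      η t.val • (χ' t * (√(D.modulus t) : ℂ))) :
    TwistedEquiv σ η (D.ind χ) (D.ind χ') where
  toFun f := ⟨fun g => η g • σ (f.val g), D.mem_indSpace_of_map hη hu h f.property⟩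
  invFun f := ⟨fun g => η g • σ.symm (f.val g), by
    refine D.mem_indSpace_of_map hη hu (fun t => ?_) f.property
    rw [RingEquiv.symm_apply_eq, Units.smul_def, map_zsmul, ← Units.smul_def, h, smul_smul,
      Int.units_mul_self, one_smul]⟩
  left_inv f := by
    ext g
    change η g • σ.symm (η g • σ (f.val g)) = f.val g
    rw [Units.smul_def (η g) (σ _), map_zsmul, ← Units.smul_def, RingEquiv.symm_apply_apply,
      smul_smul, Int.units_mul_self, one_smul]
  right_inv f := by
    ext g
    change η g • σ (η g • σ.symm (f.val g)) = f.val g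
    rw [Units.smul_def (η g) (σ.symm _), map_zsmul, ← Units.smul_def, RingEquiv.apply_symm_apply,
      smul_smul, Int.units_mul_self, one_smul]
  map_add' f f' := by
    ext g
    change η g • σ (f.val g + f'.val g) = η g • σ (f.val g) + η g • σ (f'.val g)
    rw [map_add, smul_add]
  map_smul' c f := by
    ext g
    change η g • σ (c * f.val g) = σ c * η g • σ (f.val g)
    rw [map_mul, mul_smul_comm]
  map_rep g f := by
    ext x
    change η x • σ (f.val (x * g)) = η g • η (x * g) • σ (f.val (x * g))
    rw [smul_smul, map_mul, mul_comm (η x), ← mul_assoc, Int.units_mul_self, one_mul]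

variable {V W V' W' : Type*} [AddCommGroup V] [Module ℂ V] [AddCommGroup V'] [Module ℂ V']
  [AddCommGroup W] [Module ℂ W] [AddCommGroup W'] [Module ℂ W']

/-- The sign character `s ^ ord` of the square root of the modulus character is the product of the
restriction of `η` to the torus and the unramified character with all parameters equal to `ε`. -/
structure GroupDatum.IsModulusSign (D : GroupDatum k R m r) (s : ℤˣ) (η : D.group →* ℤˣ)
    (ε : ℤˣ) : Prop where
  singleton : D.HasSingletonBlocks
  isOpen : IsOpen {g | η g = 1}
  integral : ∀ g ∈ D.integral, η g = 1
  unipotent : ∀ u ∈ D.unipotent, η u = 1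
  sign_det_Ad : ∀ t : D.torus, s ^ ord k (LinearMap.det (D.Ad t)) =
    η t.val * unramifiedSign R ε (D.torusProd singleton t)

namespace GroupDatum.IsModulusSign

variable {D : GroupDatum k R m r} {σ : ℂ ≃+* ℂ} {η : D.group →* ℤˣ} {ε : ℤˣ}

theorem hasSatakeParameter (hD : D.IsModulusSign (sqrtSign σ (Nat.card 𝓀[k])) η ε)
    {π : Representation ℂ D.group V} {π' : Representation ℂ D.group V'}
    (e : TwistedEquiv σ η π π') {α : Fin r → ℂˣ} (h : D.HasSatakeParameter π α) :
    D.HasSatakeParameter π' fun i => complexSign ε * Units.map (σ : ℂ →* ℂ) (α i) := by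
  obtain ⟨unramified, χ, hχ, sub⟩ := h
  let χ' : D.torus →* ℂˣ := complexSign.comp ((unramifiedSign R ε).comp
    (D.torusProd hD.singleton)) * (Units.map (σ : ℂ →* ℂ)).comp χ
  have hχ' (t : D.torus) : χ' t = ∏ i : Fin r, (complexSign ε * Units.map (σ : ℂ →* ℂ) (α i)) ^
      ord R (t.val.val.val (D.coordIndex i) (D.coordIndex i)) := by
    simp only [χ', MonoidHom.mul_apply, MonoidHom.comp_apply, hχ, D.torusProd_apply, map_prod,
      unramifiedSign_apply, D.torusEntry_apply, map_zpow, mul_zpow, Finset.prod_mul_distrib]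
  refine ⟨unramified.of_twistedEquiv e hD.isOpen hD.integral, χ', hχ',
    e.isSubquotient (D.indEquiv σ η hD.isOpen hD.unipotent χ χ' fun t => ?_) sub⟩
  have hχ't : (χ' t : ℂ) = unramifiedSign R ε (D.torusProd hD.singleton t) • σ (χ t) :=
    (sign_smul _ _).symm
  rw [map_mul, GroupDatum.modulus, map_sqrt_normAbs σ (D.det_Ad_ne_zero t), hD.sign_det_Ad, hχ't,
    mul_smul_comm, smul_mul_assoc, smul_smul]

variable {N : ℕ} {ζ : (gl R N).group →* ℤˣ} {ε' : ℤˣ}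
  {L : (Fin r → ℂˣ) → Matrix (Fin N) (Fin N) ℂ} {π : Representation ℂ D.group V}
  {π' : Representation ℂ D.group V'} {Pi : Representation ℂ (gl R N).group W}
  {Pi' : Representation ℂ (gl R N).group W'}

theorem isTransfer (hD : D.IsModulusSign (sqrtSign σ (Nat.card 𝓀[k])) η ε)
    (hgl : (gl R N).IsModulusSign (sqrtSign σ (Nat.card 𝓀[R])) ζ ε')
    (hL : ∀ α, L (fun i => complexSign ε * Units.map (σ : ℂ →* ℂ) (α i)) = ε' • (L α).map σ)
    (e : TwistedEquiv σ η π π') (f : TwistedEquiv σ ζ Pi Pi') (h : IsTransfer D L π Pi) :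
    IsTransfer D L π' Pi' := by
  obtain ⟨α, β, hα, hβ, P, hP⟩ := h
  refine ⟨_, _, hD.hasSatakeParameter e hα, hgl.hasSatakeParameter f hβ,
    Matrix.GeneralLinearGroup.map (σ : ℂ →+* ℂ) P, ?_⟩
  have hPσ : P.val.map σ * (L α).map σ * (P⁻¹).val.map σ = Matrix.diagonal fun i => σ (β i) := by
    rw [← Matrix.map_mul, ← Matrix.map_mul, hP, Matrix.diagonal_map (map_zero σ)]
  rw [hL, Matrix.mul_smul, Matrix.smul_mul]
  refine (congrArg (ε' • ·) hPσ).trans ?_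
  ext i j
  simp [Matrix.diagonal_apply, sign_smul]

theorem isTransfer_iff (hD : D.IsModulusSign (sqrtSign σ (Nat.card 𝓀[k])) η ε)
    (hgl : (gl R N).IsModulusSign (sqrtSign σ (Nat.card 𝓀[R])) ζ ε')
    (hL : ∀ (σ : ℂ ≃+* ℂ) α,
      L (fun i => complexSign ε * Units.map (σ : ℂ →* ℂ) (α i)) = ε' • (L α).map σ)
    (e : TwistedEquiv σ η π π') (f : TwistedEquiv σ ζ Pi Pi') :
    IsTransfer D L π Pi ↔ IsTransfer D L π' Pi' := by
  refine ⟨hD.isTransfer hgl (hL σ) e f, ?_⟩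
  rw [← sqrtSign_symm] at hD hgl
  exact hD.isTransfer hgl (hL σ.symm) e.symm f.symm

end GroupDatum.IsModulusSign

end Satake

section Adjoint

theorem det_eq_of_equivariant {k M M' : Type*} [CommRing k] [AddCommGroup M] [Module k M]
    [AddCommGroup M'] [Module k M'] (e : M ≃ₗ[k] M') {f : M →ₗ[k] M} {f' : M' →ₗ[k] M'}
    (h : ∀ x, e (f x) = f' (e x)) : LinearMap.det f = LinearMap.det f' := by
  have conj_eq : e.toLinearMap ∘ₗ f ∘ₗ e.symm.toLinearMap = f' := by
    ext x
    simp [h]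
  rw [← conj_eq, LinearMap.det_conj]

variable {k R : Type*} [Field k] [Field R] [Algebra k R] {m r : ℕ}

theorem GroupDatum.Ad_apply_col (D : GroupDatum k R m r) (t : D.torus) (X : D.nilradical)
    (i : Fin m) {j : Fin m} (hj : D.IsSingletonBlock j) :
    (D.Ad t X).val i j = (∑ l, t.val.val.val i l * X.val l j) * (D.torusEntry hj t)⁻¹ := by
  change (t.val.val.val * X.val * (t⁻¹).val.val.val) i j = _
  rw [Matrix.mul_apply, Finset.sum_eq_single j _ (by simp), Matrix.mul_apply,
    ← D.torusEntry_apply hj t⁻¹, map_inv, Units.val_inv_eq_inv_val]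
  intro l _ hl
  rw [(t⁻¹.property l j fun h => hl (hj l h)).1, mul_zero]

theorem GroupDatum.Ad_apply_entry (D : GroupDatum k R m r) (t : D.torus) (X : D.nilradical)
    {i j : Fin m} (hi : D.IsSingletonBlock i) (hj : D.IsSingletonBlock j) :
    (D.Ad t X).val i j = D.torusEntry hi t * X.val i j * (D.torusEntry hj t)⁻¹ := by
  rw [D.Ad_apply_col t X i hj, Finset.sum_eq_single i _ (by simp), D.torusEntry_apply]
  intro l _ hl
  rw [(t.property i l fun h => hl (hi l h.symm)).1, zero_mul]

end Adjoint

section GeneralLinear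

variable {F : Type*} [Field F] {N : ℕ}

theorem gl_isSingletonBlock (i : Fin N) : (gl F N).IsSingletonBlock i :=
  fun _ h => Fin.ext h

theorem gl_hasSingletonBlocks : (gl F N).HasSingletonBlocks :=
  fun _ => gl_isSingletonBlock _

theorem gl_det_eq_torusProd (t : (gl F N).torus) :
    t.val.val.val.det = (gl F N).torusProd gl_hasSingletonBlocks t := by
  have diag : t.val.val.val = Matrix.diagonal fun i => t.val.val.val i i := by
    ext i j
    rcases eq_or_ne i j with rfl | h
    · rw [Matrix.diagonal_apply_eq]
    · rw [Matrix.diagonal_apply_ne _ h, (t.property i j fun hb => h (Fin.ext hb)).1]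
  rw [diag, Matrix.det_diagonal, (gl F N).torusProd_apply, Units.coe_prod]
  rfl

variable (F N) in
/-- The strictly upper triangular entries are coordinates on the nilradical of `GL(N)`. -/
def glNilradicalEquiv : (gl F N).nilradical ≃ₗ[F] ((Σ i : Fin N, Finset.Ioi i) → F) where
  toFun X p := X.val p.1 p.2
  invFun x := ⟨fun i j => if h : i < j then x ⟨i, j, Finset.mem_Ioi.mpr h⟩ else 0,
    Submodule.mem_top, fun i j h => dif_neg (not_lt.mpr h)⟩
  map_add' _ _ := rfl
  map_smul' _ _ := rfl
  left_inv X := by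
    ext i j
    rcases lt_or_ge i j with h | h
    · exact dif_pos h
    · exact (dif_neg (not_lt.mpr h)).trans (X.property.2 i j h).symm
  right_inv x := by
    ext p
    exact dif_pos (Finset.mem_Ioi.mp p.2.property)

theorem gl_det_Ad (t : (gl F N).torus) : LinearMap.det ((gl F N).Ad t) =
    ((gl F N).torusProd gl_hasSingletonBlocks t ^ (N + 1) *
      ((∏ i : Fin N, ∏ j ∈ Finset.Ici i, (gl F N).torusEntry (gl_isSingletonBlock j) t)⁻¹) ^ 2 :
      Fˣ) := by
  let a (i : Fin N) : Fˣ := (gl F N).torusEntry (gl_isSingletonBlock i) t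
  have diagonal_action : LinearMap.det ((gl F N).Ad t) =
      LinearMap.det (LinearMap.pi fun p : Σ i : Fin N, Finset.Ioi i =>
        LinearMap.mulLeft F ((a p.1 * (a p.2)⁻¹ : Fˣ) : F) ∘ₗ LinearMap.proj p) := by
    refine det_eq_of_equivariant (glNilradicalEquiv F N) fun X => funext fun p => ?_
    change ((gl F N).Ad t X).val p.1 p.2 = (a p.1 * (a p.2)⁻¹ : Fˣ) * X.val p.1 p.2
    rw [(gl F N).Ad_apply_entry t X (gl_isSingletonBlock _) (gl_isSingletonBlock _), Units.val_mul,
      Units.val_inv_eq_inv_val, mul_right_comm]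
  have prod_pairs : ∏ i, ∏ j ∈ Finset.Ici i, a i * a j = (∏ i, a i) ^ (N + 1) :=
    calc ∏ i, ∏ j ∈ Finset.Ici i, a i * a j
        = ∏ i, (a i ^ 2 * ∏ j ∈ Finset.Ioi i, a i * a j) := by
          simp only [← Finset.mul_prod_Ioi_eq_prod_Ici, sq]
      _ = ∏ i, (a i ^ 2 * ∏ _j ∈ {i}ᶜ, a i) := by
          rw [Finset.prod_mul_distrib, Finset.prod_mul_distrib,
            Finset.prod_prod_Ioi_mul_eq_prod_prod_off_diag fun _ i => a i]
      _ = (∏ i, a i) ^ (N + 1) := by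
          rw [← Finset.prod_pow]
          refine Finset.prod_congr rfl fun i _ => ?_
          rw [Finset.prod_const, Finset.card_compl, Finset.card_singleton, Fintype.card_fin,
            ← pow_add]
          have := i.pos
          congr 1
          lia
  have prod_quotients : ∏ p : Σ i : Fin N, Finset.Ioi i, a p.1 * (a p.2)⁻¹ =
      (∏ i, a i) ^ (N + 1) * ((∏ i : Fin N, ∏ j ∈ Finset.Ici i, a j)⁻¹) ^ 2 := by
    rw [← prod_pairs, Fintype.prod_sigma, inv_pow, ← div_eq_mul_inv]
    simp only [← Finset.prod_pow, ← Finset.prod_div_distrib]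
    refine Finset.prod_congr rfl fun i _ => ?_
    rw [Finset.prod_coe_sort (Finset.Ioi i) fun j => a i * (a j)⁻¹,
      ← Finset.mul_prod_Ioi_eq_prod_Ici, ← sq, div_self', one_mul]
    exact Finset.prod_congr rfl fun j _ => by
      rw [sq, mul_div_mul_right_eq_div, div_eq_mul_inv]
  rw [diagonal_action, LinearMap.det_pi, GroupDatum.torusProd_apply, ← prod_quotients]
  simp

variable [ValuativeRel F]

theorem det_mem_integer {n : Type*} [Fintype n] [DecidableEq n] {A : Matrix n n F}
    (hA : ∀ i j, A i j ∈ 𝒪[F]) :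
    A.det ∈ 𝒪[F] := by
  rw [Matrix.det_apply]
  exact sum_mem fun τ _ => zsmul_mem (prod_mem fun i _ => hA _ _) _

variable [TopologicalSpace F] [IsNonarchimedeanLocalField F]

variable (F N) in
/-- The unramified character `g ↦ ε ^ ord(det g)` of `GL(N)`. -/
def ordDetCharacter (ε : ℤˣ) : (gl F N).group →* ℤˣ :=
  (unramifiedSign F ε).comp (Matrix.GeneralLinearGroup.det.comp (gl F N).group.subtype)

theorem ordDetCharacter_apply (ε : ℤˣ) (g : (gl F N).group) :
    ordDetCharacter F N ε g = ε ^ ord F g.val.val.det := rfl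

theorem ordDetCharacter_of_det_mem_integer (ε : ℤˣ) {g : (gl F N).group}
    (h : g.val.val.det ∈ 𝒪[F]) (h' : (g⁻¹).val.val.det ∈ 𝒪[F]) :
    ordDetCharacter F N ε g = 1 := by
  have mul_inv : g.val.val.det * (g⁻¹).val.val.det = 1 := by
    rw [← Matrix.det_mul]
    exact (congrArg Matrix.det g.val.mul_inv).trans Matrix.det_one
  rw [ordDetCharacter_apply, ord_eq_zero_of_mul_eq_one h h' mul_inv, zpow_zero]

theorem isOpen_ordDetCharacter (ε : ℤˣ) : IsOpen {g | ordDetCharacter F N ε g = 1} := by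
  refine (ordDetCharacter F N ε).ker.isOpen_of_mem_nhds (g := 1) ?_
  have continuous_det : Continuous fun g : (gl F N).group => g.val.val.det :=
    (Units.continuous_val.comp continuous_subtype_val).matrix_det
  have isOpen_integer : IsOpen (𝒪[F] : Set F) := Valuation.isOpen_integer
  refine Filter.mem_of_superset (((isOpen_integer.preimage continuous_det).inter
    (isOpen_integer.preimage (continuous_det.comp continuous_inv))).mem_nhds ⟨?_, ?_⟩) ?_
  · simp
  · simp
  · rintro g ⟨h, h'⟩
    exact ordDetCharacter_of_det_mem_integer ε h h'

theorem gl_isModulusSign {s ε₁ ε₂ : ℤˣ} (h : ε₁ * ε₂ = s ^ (N + 1)) :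
    (gl F N).IsModulusSign s (ordDetCharacter F N ε₁) ε₂ where
  singleton := gl_hasSingletonBlocks
  isOpen := isOpen_ordDetCharacter ε₁
  integral g hg := ordDetCharacter_of_det_mem_integer ε₁ (det_mem_integer fun i j => (hg i j).1)
    (det_mem_integer fun i j => (hg i j).2)
  unipotent u hu := by
    have det_eq_one : u.val.val.det = 1 := by
      rw [Matrix.det_of_isUpperTriangular fun i j hij => (hu i j (le_of_lt hij)).trans
        (Matrix.one_apply_ne (ne_of_gt hij))]
      exact Finset.prod_eq_one fun i _ => (hu i i le_rfl).trans (Matrix.one_apply_eq i)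
    rw [ordDetCharacter_apply, det_eq_one, ord_one, zpow_zero]
  sign_det_Ad t := by
    rw [gl_det_Ad, ordDetCharacter_apply, gl_det_eq_torusProd, ← unramifiedSign_apply,
      ← unramifiedSign_apply, map_mul, map_pow, map_pow, Int.units_sq, mul_one,
      unramifiedSign_apply, unramifiedSign_apply, unramifiedSign_apply, ← mul_zpow, h,
      ← zpow_natCast, ← zpow_natCast, zpow_comm]

theorem map_absDet_half (σ : ℂ ≃+* ℂ) (g : (gl F N).group) :
    σ (absDet F N (1 / 2) g) =
      ordDetCharacter F N (sqrtSign σ (Nat.card 𝓀[F])) g • absDet F N (1 / 2) g := by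
  have absDet_half : absDet F N (1 / 2) g = (√(normAbs F g.val.val.det) : ℂ) := by
    rw [Real.sqrt_eq_rpow]
    rfl
  rw [absDet_half, map_sqrt_normAbs σ (Matrix.isUnits_det_units g.val).ne_zero]
  rfl

theorem absDet_half_mul (g : (gl F N).group) :
    absDet F N (1 / 2) g * absDet F N (-(1 / 2)) g = 1 := by
  have normAbs_det_pos : 0 < normAbs F g.val.val.det :=
    normAbs_pos (Matrix.isUnits_det_units g.val).ne_zero
  change ((normAbs F g.val.val.det ^ (1 / 2 : ℝ) : ℝ) : ℂ) *
    ((normAbs F g.val.val.det ^ (-(1 / 2) : ℝ) : ℝ) : ℂ) = 1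
  rw [← Complex.ofReal_mul, ← Real.rpow_add normAbs_det_pos, add_neg_cancel, Real.rpow_zero,
    Complex.ofReal_one]

variable {W : Type*} [AddCommGroup W] [Module ℂ W]

/-- The representation `^σ(ρ ⊗ | |^{-1/2}) ⊗ | |^{1/2}` is the conjugate of `ρ`, twisted by an
unramified quadratic character. -/
def TwistedEquiv.absDetTwist (σ : ℂ ≃+* ℂ) (ρ : Representation ℂ (gl F N).group W) :
    TwistedEquiv σ (ordDetCharacter F N (sqrtSign σ (Nat.card 𝓀[F]))) ρ
      (twist (absDet F N (1 / 2)) (conjRep σ (twist (absDet F N (-(1 / 2))) ρ))) where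
  toLinearEquiv := (TwistedEquiv.conj σ ρ).toLinearEquiv
  map_rep g v := by
    have map_symm : σ.symm (absDet F N (1 / 2) g) =
        ordDetCharacter F N (sqrtSign σ (Nat.card 𝓀[F])) g • absDet F N (1 / 2) g := by
      rw [← sqrtSign_symm, map_absDet_half]
    change (ρ g v : W) = ordDetCharacter F N (sqrtSign σ (Nat.card 𝓀[F])) g •
      σ.symm (absDet F N (1 / 2) g) • absDet F N (-(1 / 2)) g • ρ g v
    rw [map_symm, smul_assoc, smul_smul, Int.units_mul_self, one_smul, smul_smul,
      absDet_half_mul, one_smul]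

end GeneralLinear

theorem det_blockDiagonal' {ι R : Type*} {n : ι → Type*} [LinearOrder ι] [Fintype ι]
    [∀ i, Fintype (n i)] [∀ i, DecidableEq (n i)] [CommRing R] (M : ∀ i, Matrix (n i) (n i) R) :
    (Matrix.blockDiagonal' M).det = ∏ i, (M i).det := by
  rw [(Matrix.blockTriangular_blockDiagonal' M).det_fintype]
  refine Finset.prod_congr rfl fun i _ => ?_
  rw [← Matrix.det_reindex_self (Equiv.sigmaSubtype i).symm]
  congr 1
  ext ⟨⟨a, b⟩, rfl⟩ ⟨⟨a', b'⟩, h⟩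
  obtain rfl : a' = a := h
  exact Matrix.blockDiagonal'_apply_eq _ _ _ _

theorem blockDiagonal'_mulVec {ι R : Type*} {n : ι → Type*} [DecidableEq ι] [Fintype ι]
    [∀ i, Fintype (n i)] [NonUnitalNonAssocSemiring R] (M : ∀ i, Matrix (n i) (n i) R)
    (v : (Σ i, n i) → R) (i : ι) (a : n i) :
    (Matrix.blockDiagonal' M).mulVec v ⟨i, a⟩ = (M i).mulVec (fun b => v ⟨i, b⟩) a := by
  simp only [Matrix.mulVec, dotProduct, Fintype.sum_sigma]
  rw [Finset.sum_eq_single i (fun j _ hj => ?_) (by simp)]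
  · simp only [Matrix.blockDiagonal'_apply_eq]
  · simp only [Matrix.blockDiagonal'_apply_ne M _ _ hj.symm, zero_mul, Finset.sum_const_zero]

section IsometryGroup

variable {k R : Type*} [Field k] [Field R] [Algebra k R] {m r : ℕ}

theorem GroupDatum.rev_coordIndex_injective (D : GroupDatum k R m r) :
    Function.Injective fun i => (D.coordIndex i).rev :=
  Fin.rev_injective.comp (Fin.castLE_injective D.rank_le)

theorem GroupDatum.position_injective (D : GroupDatum k R m r) :
    Function.Injective fun p : Σ i, Finset.Ioo (D.coordIndex i) (D.coordIndex i).rev =>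
      ((p.2 : Fin m), (D.coordIndex p.1).rev) := by
  rintro ⟨i, l⟩ ⟨i', l'⟩ h
  obtain rfl : i = i' := D.rev_coordIndex_injective (congrArg Prod.snd h)
  obtain rfl : l = l' := Subtype.ext (congrArg Prod.fst h)
  rfl

/-- The matrix which inverts `J` on the isotropic vectors and vanishes on the other ones. -/
def GroupDatum.isotropicInverse (D : GroupDatum k R m r)
    (J : Matrix (Fin m) (Fin m) R) : Matrix (Fin m) (Fin m) R :=
  fun i j => if D.block i < D.block i.rev ∧ j = i.rev then (J j i)⁻¹ else 0

theorem GroupDatum.isotropicInverse_mul_apply (D : GroupDatum k R m r)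
    (J A : Matrix (Fin m) (Fin m) R) (i j : Fin m) :
    (D.isotropicInverse J * A) i j =
      if D.block i < D.block i.rev then (J i.rev i)⁻¹ * A i.rev j else 0 := by
  split_ifs with hi
  · rw [Matrix.mul_apply, Finset.sum_eq_single i.rev (fun l _ hl => ?_) (by simp)]
    · rw [isotropicInverse, if_pos ⟨hi, rfl⟩]
    · rw [isotropicInverse, if_neg fun h => hl h.2, zero_mul]
  · rw [Matrix.mul_apply]
    refine Finset.sum_eq_zero fun l _ => ?_
    rw [isotropicInverse, if_neg fun h => hi h.1, zero_mul]

/-- The part of an element of the torus between the basis vectors `i` and `i.rev`. -/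
def GroupDatum.innerBlock (D : GroupDatum k R m r) (t : D.torus) (i : Fin r) :
    Matrix (Finset.Ioo (D.coordIndex i) (D.coordIndex i).rev)
      (Finset.Ioo (D.coordIndex i) (D.coordIndex i).rev) R :=
  t.val.val.val.submatrix Subtype.val Subtype.val

/-- The group of a form with Gram matrix `J` that is `ε`-Hermitian for the involution `c`: the
basis vectors `i` and `i.rev` span a hyperbolic plane, except that the middle block, of size at
most two, carries an arbitrary form. -/
structure GroupDatum.IsQuasiSplit (D : GroupDatum k R m r) (c : R ≃ₐ[k] R)
    (J : Matrix (Fin m) (Fin m) R) (ε : R) : Prop where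
  group_le : D.group ≤ isometryGroup c J
  lie_eq : D.lie = isometryLie c J
  monotone_block : Monotone D.block
  eq_or_eq_rev : ∀ {i j}, D.block i = D.block j → j = i ∨ j = i.rev
  isotropic_iff : ∀ i : Fin m, D.block i < D.block i.rev ↔ (i : ℕ) < r
  gram_eq_zero : ∀ {i j}, D.block j ≠ D.block i.rev → J i j = 0
  gram_ne_zero : ∀ {i}, D.block i ≠ D.block i.rev → J i i.rev ≠ 0
  gram_conj : ∀ i j, c (J j i) = ε * J i j
  sq_eq_one : ε * ε = 1
  conj_conj : ∀ x, c (c x) = x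

/-- The elements `w` with `c(w) = -ε w`: the values on the isotropic vectors of the root spaces
which the involution of the Lie algebra preserves. -/
def antiHermitian (c : R ≃ₐ[k] R) (ε : R) : Submodule k R :=
  LinearMap.ker (c.toLinearMap + LinearMap.mulLeft k ε)

theorem mem_antiHermitian {c : R ≃ₐ[k] R} {ε w : R} :
    w ∈ antiHermitian c ε ↔ c w + ε * w = 0 := Iff.rfl

namespace GroupDatum.IsQuasiSplit

variable {D : GroupDatum k R m r} {c : R ≃ₐ[k] R} {J : Matrix (Fin m) (Fin m) R} {ε : R}

theorem isSingletonBlock (hD : D.IsQuasiSplit c J ε) {i : Fin m}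
    (hi : D.block i ≠ D.block i.rev) : D.IsSingletonBlock i :=
  fun _ h => (hD.eq_or_eq_rev h.symm).resolve_right fun hj => hi (hj ▸ h.symm)

theorem block_lt_rev (hD : D.IsQuasiSplit c J ε) (i : Fin r) :
    D.block (D.coordIndex i) < D.block (D.coordIndex i).rev :=
  (hD.isotropic_iff _).mpr i.isLt

theorem hasSingletonBlocks (hD : D.IsQuasiSplit c J ε) : D.HasSingletonBlocks :=
  fun i => hD.isSingletonBlock (hD.block_lt_rev i).ne

theorem block_ne_of_notMem_Ioo (hD : D.IsQuasiSplit c J ε) {i : Fin r} {l : Fin m}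
    (hl : l ∉ Finset.Ioo (D.coordIndex i) (D.coordIndex i).rev) : D.block l ≠ D.block l.rev := by
  rw [Finset.mem_Ioo, not_and_or, not_lt, not_lt] at hl
  rcases hl with hl | hl
  · exact ((hD.monotone_block hl).trans_lt <| (hD.block_lt_rev i).trans_le <|
      hD.monotone_block (Fin.rev_le_rev.mpr hl)).ne
  · exact ((hD.monotone_block (Fin.rev_le_iff.mpr hl)).trans_lt <|
      (hD.block_lt_rev i).trans_le (hD.monotone_block hl)).ne'

theorem isSingletonBlock_rev (hD : D.IsQuasiSplit c J ε) (i : Fin r) :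
    D.IsSingletonBlock (D.coordIndex i).rev :=
  hD.isSingletonBlock (by rw [Fin.rev_rev]; exact (hD.block_lt_rev i).ne')

theorem gram_rev_ne_zero (hD : D.IsQuasiSplit c J ε) {i : Fin m}
    (hi : D.block i ≠ D.block i.rev) : J i.rev i ≠ 0 := by
  have := hD.gram_ne_zero (i := i.rev) (by rwa [Fin.rev_rev, ne_comm])
  rwa [Fin.rev_rev] at this

theorem gram_eq_zero_of_ne_rev (hD : D.IsQuasiSplit c J ε) {i j : Fin m}
    (hj : D.block j ≠ D.block j.rev) (hi : i ≠ j.rev) : J i j = 0 :=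
  hD.gram_eq_zero fun h => hi (by rw [← hD.isSingletonBlock hj _ h.symm, Fin.rev_rev])

theorem gram_mul_apply_rev (hD : D.IsQuasiSplit c J ε) {i : Fin m}
    (hi : D.block i ≠ D.block i.rev) (X : Matrix (Fin m) (Fin m) R) (j : Fin m) :
    (J * X) i.rev j = J i.rev i * X i j := by
  rw [Matrix.mul_apply, Finset.sum_eq_single i (fun l _ hl => ?_) (by simp)]
  rw [hD.gram_eq_zero fun h => hl (hD.isSingletonBlock hi l (by rw [h, Fin.rev_rev])), zero_mul]

theorem conj_apply_mul_apply_rev (hD : D.IsQuasiSplit c J ε) (t : D.torus) {i : Fin m}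
    (hi : D.block i ≠ D.block i.rev) : c (t.val.val.val i i) * t.val.val.val i.rev i.rev = 1 := by
  have isometry : ((t.val.val.val.map c).transpose * J * t.val.val.val) i i.rev = J i i.rev :=
    congrFun₂ (hD.group_le t.val.property : _ = J) _ _
  rw [Matrix.mul_apply, Finset.sum_eq_single i.rev _ (by simp), Matrix.mul_apply,
    Finset.sum_eq_single i _ (by simp), Matrix.transpose_apply, Matrix.map_apply] at isometry
  · refine mul_right_cancel₀ (hD.gram_ne_zero hi) ?_
    linear_combination isometry
  · intro l _ hl
    rw [Matrix.transpose_apply, Matrix.map_apply,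
      (t.property _ _ fun h => hl (hD.isSingletonBlock hi l h)).1, map_zero, zero_mul]
  · intro l _ hl
    have hi' : D.block i.rev ≠ D.block i.rev.rev := by rwa [Fin.rev_rev, ne_comm]
    rw [(t.property _ _ fun h => hl (hD.isSingletonBlock hi' l h)).1, mul_zero]

theorem block_eq_block_rev_symm (hD : D.IsQuasiSplit c J ε) {i j : Fin m}
    (h : D.block i = D.block j.rev) : D.block j = D.block i.rev := by
  rcases hD.eq_or_eq_rev h with rfl | hj
  · rw [Fin.rev_rev]
  · rw [Fin.rev_injective hj] at h ⊢
    exact h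

theorem mem_Ioo_of_block_eq_block_rev (hD : D.IsQuasiSplit c J ε) {i j l : Fin m}
    (h : D.block j = D.block l.rev) (hij : i < j) (hji : j < i.rev) : i < l ∧ l < i.rev := by
  have hl : l = j ∨ l = j.rev :=
    (hD.eq_or_eq_rev h).symm.imp Fin.rev_injective.eq_iff.mp Fin.rev_eq_iff.mp
  rcases hl with rfl | rfl
  · exact ⟨hij, hji⟩
  · exact ⟨Fin.lt_rev_iff.mpr hji, Fin.rev_lt_rev.mpr hij⟩

theorem eq_zero_of_coordinates_eq_zero (hD : D.IsQuasiSplit c J ε)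
    {X : Matrix (Fin m) (Fin m) R} (hX : X ∈ D.nilradical)
    (h : ∀ i : Fin m, D.block i < D.block i.rev → ∀ l, i ≤ l → l < i.rev → X l i.rev = 0) :
    X = 0 := by
  ext i j
  rcases le_or_gt (D.block j) (D.block i) with hij | hij
  · exact hX.2 i j hij
  rcases le_or_gt j.rev i with hji | hji
  · have column := h j.rev (by
      rw [Fin.rev_rev]
      exact (hD.monotone_block hji).trans_lt hij) i hji
    rw [Fin.rev_rev] at column
    exact column (hD.monotone_block.reflect_lt hij)
  · have hj : j < i.rev := Fin.lt_rev_iff.mpr hji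
    have hi : D.block i < D.block i.rev := hij.trans_le (hD.monotone_block hj.le)
    have lie : ((X.map c).transpose * J + J * X) i.rev j = 0 :=
      congrFun₂ (hD.lie_eq.le hX.1 : _ = (0 : Matrix (Fin m) (Fin m) R)) _ _
    have column : ((X.map c).transpose * J) i.rev j = 0 := by
      rw [Matrix.mul_apply]
      refine Finset.sum_eq_zero fun l _ => ?_
      by_cases hl : D.block j = D.block l.rev
      · have hil : i < l ∧ l < i.rev :=
          hD.mem_Ioo_of_block_eq_block_rev hl (hD.monotone_block.reflect_lt hij) hj
        rw [Matrix.transpose_apply, Matrix.map_apply, h i hi l hil.1.le hil.2, map_zero, zero_mul]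
      · rw [hD.gram_eq_zero hl, mul_zero]
    rw [Matrix.add_apply, column, hD.gram_mul_apply_rev hi.ne, zero_add] at lie
    exact (mul_eq_zero.mp lie).resolve_left (hD.gram_rev_ne_zero hi.ne)

theorem gram_mul_isotropicInverse_mul (hD : D.IsQuasiSplit c J ε) {A : Matrix (Fin m) (Fin m) R}
    (hA : ∀ i j, A i j ≠ 0 → D.block i.rev < D.block i) :
    J * (D.isotropicInverse J * A) = A := by
  ext i j
  rw [Matrix.mul_apply, Finset.sum_eq_single i.rev (fun l _ hl => ?_) (by simp),
    D.isotropicInverse_mul_apply, Fin.rev_rev]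
  · split_ifs with hi
    · rw [mul_inv_cancel_left₀ (hD.gram_ne_zero hi.ne')]
    · rw [mul_zero, not_imp_comm.mp (hA i j) hi]
  · rw [D.isotropicInverse_mul_apply]
    split_ifs with hl'
    · rw [hD.gram_eq_zero_of_ne_rev hl'.ne fun h => hl (by rw [h, Fin.rev_rev]), zero_mul]
    · rw [mul_zero]

theorem add_mul_mem_lie (hD : D.IsQuasiSplit c J ε) {Y P W : Matrix (Fin m) (Fin m) R}
    (hY : J * (P * (Y.map c).transpose) = (Y.map c).transpose) (hW : J * (P * W) = W)
    (hWW : ε • (W.map c).transpose + W = 0) :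
    Y + P * (W - (Y.map c).transpose * J) ∈ D.lie := by
  have star_star (A : Matrix (Fin m) (Fin m) R) :
      ((A.map c).transpose.map c).transpose = A := by
    ext i j
    exact hD.conj_conj _
  have star_mul (A B : Matrix (Fin m) (Fin m) R) :
      ((A * B).map c).transpose = (B.map c).transpose * (A.map c).transpose := by
    rw [Matrix.map_mul, Matrix.transpose_mul]
  have star_gram : (J.map c).transpose = ε • J := by
    ext i j
    exact hD.gram_conj i j
  have star_inverse {A : Matrix (Fin m) (Fin m) R} (hA : J * (P * A) = A) :
      (A.map c).transpose * (P.map c).transpose * J = ε • (A.map c).transpose := by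
    conv_rhs => rw [← hA, star_mul, star_mul, star_gram, Matrix.mul_smul, smul_smul, hD.sq_eq_one,
      one_smul]
  have star_add : ((Y + P * (W - (Y.map c).transpose * J)).map c).transpose * J =
      (Y.map c).transpose * J + ε • (W.map c).transpose - J * Y := by
    have hY' := star_inverse hY
    rw [star_star] at hY'
    rw [Matrix.map_add _ (map_add c), Matrix.transpose_add, star_mul,
      Matrix.map_sub _ (map_sub c), Matrix.transpose_sub, star_mul, star_star, star_gram, sub_mul,
      add_mul, sub_mul, star_inverse hW, Matrix.mul_assoc, Matrix.mul_assoc, ← Matrix.mul_assoc Y,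
      hY', Matrix.smul_mul, Matrix.mul_smul, smul_smul, hD.sq_eq_one, one_smul, add_sub_assoc]
  rw [hD.lie_eq]
  change ((Y + P * (W - (Y.map c).transpose * J)).map c).transpose * J +
    J * (Y + P * (W - (Y.map c).transpose * J)) = 0
  rw [star_add, mul_add, mul_sub, mul_sub, hW, ← Matrix.mul_assoc P, ← Matrix.mul_assoc J, hY]
  rw [eq_neg_of_add_eq_zero_left hWW]
  abel

theorem conjTranspose_mul_gram_eq_zero (hD : D.IsQuasiSplit c J ε)
    {Y : Matrix (Fin m) (Fin m) R} (hY : ∀ i j, Y i j ≠ 0 → j.rev < i ∧ i < j) {i j : Fin m}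
    (h : ¬(i.rev < j ∧ j < i)) : ((Y.map c).transpose * J) i j = 0 := by
  rw [Matrix.mul_apply]
  refine Finset.sum_eq_zero fun l _ => ?_
  rw [Matrix.transpose_apply, Matrix.map_apply]
  by_contra h_ne
  obtain ⟨hl, hl'⟩ := hY l i fun h => h_ne (by rw [h, map_zero, zero_mul])
  have gram : D.block l = D.block j.rev := hD.block_eq_block_rev_symm <| by
    by_contra hb
    rw [hD.gram_eq_zero hb, mul_zero] at h_ne
    exact h_ne rfl
  have hj := hD.mem_Ioo_of_block_eq_block_rev gram hl (by rw [Fin.rev_rev]; exact hl')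
  rw [Fin.rev_rev] at hj
  exact h hj

theorem exists_mem_nilradical (hD : D.IsQuasiSplit c J ε) {Y W : Matrix (Fin m) (Fin m) R}
    (hY : ∀ i j, Y i j ≠ 0 → D.block j.rev < D.block j ∧ j.rev < i ∧ i < j)
    (hW : ∀ i j, W i j ≠ 0 → D.block i.rev < D.block i ∧ j = i)
    (hWW : ε • (W.map c).transpose + W = 0) :
    ∃ X ∈ D.nilradical, ∀ i, D.block i < D.block i.rev →
      (∀ l, i < l → l < i.rev → X l i.rev = Y l i.rev) ∧ J i.rev i * X i i.rev = W i.rev i.rev := by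
  have hY' (i j : Fin m) (h : ¬(j.rev < i ∧ i < j)) : Y i j = 0 :=
    not_imp_comm.mp (fun h => (hY i j h).2) h
  have hYJ (i j : Fin m) (h : ¬(i.rev < j ∧ j < i)) : ((Y.map c).transpose * J) i j = 0 :=
    hD.conjTranspose_mul_gram_eq_zero (fun i j h => (hY i j h).2) h
  have apply_eq (i j : Fin m) :
      (Y + D.isotropicInverse J * (W - (Y.map c).transpose * J)) i j = Y i j +
        if D.block i < D.block i.rev then
          (J i.rev i)⁻¹ * (W i.rev j - ((Y.map c).transpose * J) i.rev j) else 0 := by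
    rw [Matrix.add_apply, D.isotropicInverse_mul_apply, Matrix.sub_apply]
  refine ⟨Y + D.isotropicInverse J * (W - (Y.map c).transpose * J),
    ⟨hD.add_mul_mem_lie (hD.gram_mul_isotropicInverse_mul fun i j h =>
      (hY j i fun h' => h (by simp [h'])).1) (hD.gram_mul_isotropicInverse_mul fun i j h =>
      (hW i j h).1) hWW, fun i j hij => ?_⟩, fun i hi => ⟨fun l hl _ => ?_, ?_⟩⟩
  · have hY0 : Y i j = 0 := by
      by_contra h
      obtain ⟨hj, -, hlt⟩ := hY i j h
      exact hlt.ne (hD.isSingletonBlock hj.ne' i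
        (hij.antisymm (hD.monotone_block hlt.le)).symm)
    rw [apply_eq, hY0, zero_add, ite_eq_right_iff]
    intro hi
    have hji : ¬i < j := fun h =>
      h.ne' (hD.isSingletonBlock hi.ne j (hij.antisymm (hD.monotone_block h.le)))
    rw [hYJ _ _ fun h => hji (by simpa using h.1), not_imp_comm.mp (fun h => (hW i.rev j h).2)
      fun h => hij.not_gt (h ▸ hi), sub_zero, mul_zero]
  · rw [apply_eq, hYJ _ _ fun h => (Fin.rev_lt_rev.mp h.2).not_gt hl,
      not_imp_comm.mp (fun h => (hW l.rev i.rev h).2) fun h => hl.ne (Fin.rev_injective h),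
      sub_zero, mul_zero, ite_self, add_zero]
  · rw [apply_eq, if_pos hi, hY' _ _ (by simp), hYJ _ _ (by simp), zero_add, sub_zero,
      mul_inv_cancel_left₀]
    exact hD.gram_rev_ne_zero hi.ne

theorem gram_mul_antidiagonal_mem (hD : D.IsQuasiSplit c J ε)
    {X : Matrix (Fin m) (Fin m) R} (hX : X ∈ D.nilradical) {i : Fin m}
    (hi : D.block i ≠ D.block i.rev) : J i.rev i * X i i.rev ∈ antiHermitian c ε := by
  have lie : ((X.map c).transpose * J + J * X) i.rev i.rev = 0 :=
    congrFun₂ (hD.lie_eq.le hX.1 : _ = (0 : Matrix (Fin m) (Fin m) R)) _ _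
  have column : ((X.map c).transpose * J) i.rev i.rev = c (X i i.rev) * J i i.rev := by
    rw [Matrix.mul_apply, Finset.sum_eq_single i (fun l _ hl => ?_) (by simp)]
    · rfl
    · rw [hD.gram_eq_zero_of_ne_rev (by rwa [Fin.rev_rev, ne_comm]) (by rwa [Fin.rev_rev]),
        mul_zero]
  rw [Matrix.add_apply, column, hD.gram_mul_apply_rev hi] at lie
  rw [mem_antiHermitian, map_mul, hD.gram_conj]
  linear_combination ε * lie

/-- The entries of `X` in the columns of the isotropic vectors `i.rev`, strictly between the rows
`i` and `i.rev`, and the normalized antidiagonal entries. -/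
def nilradicalCoordinates (hD : D.IsQuasiSplit c J ε) : D.nilradical →ₗ[k]
    ((Σ i, Finset.Ioo (D.coordIndex i) (D.coordIndex i).rev) → R) ×
      (Fin r → antiHermitian c ε) where
  toFun X := (fun p => X.val p.2 (D.coordIndex p.1).rev, fun i =>
    ⟨J (D.coordIndex i).rev (D.coordIndex i) * X.val (D.coordIndex i) (D.coordIndex i).rev,
      hD.gram_mul_antidiagonal_mem X.property (hD.block_lt_rev i).ne⟩)
  map_add' X Y := by ext <;> simp [mul_add]
  map_smul' a X := by ext <;> simp

theorem nilradicalCoordinates_injective (hD : D.IsQuasiSplit c J ε) :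
    Function.Injective hD.nilradicalCoordinates := by
  refine (injective_iff_map_eq_zero _).mpr fun X hX => Subtype.ext <|
    hD.eq_zero_of_coordinates_eq_zero X.property fun i hi l hl hl' => ?_
  let i' : Fin r := ⟨i, (hD.isotropic_iff i).mp hi⟩
  obtain rfl | hl := hl.eq_or_lt
  · have antidiagonal : J i.rev i * X.val i i.rev = 0 :=
      congrArg Subtype.val (congrFun (congrArg Prod.snd hX) i')
    exact (mul_eq_zero.mp antidiagonal).resolve_left (hD.gram_rev_ne_zero hi.ne)
  · exact congrFun (congrArg Prod.fst hX) ⟨i', l, Finset.mem_Ioo.mpr ⟨hl, hl'⟩⟩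

theorem nilradicalCoordinates_surjective (hD : D.IsQuasiSplit c J ε) :
    Function.Surjective hD.nilradicalCoordinates := by
  rintro ⟨y, w⟩
  let Y : Matrix (Fin m) (Fin m) R := fun a b =>
    Function.extend (fun p : Σ i, Finset.Ioo (D.coordIndex i) (D.coordIndex i).rev =>
      ((p.2 : Fin m), (D.coordIndex p.1).rev)) y 0 (a, b)
  let d : Fin m → R := Function.extend (fun i => (D.coordIndex i).rev) (fun i => w i) 0
  have hY (a b : Fin m) (h : Y a b ≠ 0) : D.block b.rev < D.block b ∧ b.rev < a ∧ a < b := by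
    obtain ⟨p, hp⟩ := not_imp_comm.mp (Function.extend_apply' y (0 : Fin m × Fin m → R) (a, b)) h
    obtain ⟨rfl, rfl⟩ := Prod.ext_iff.mp hp
    rw [Fin.rev_rev]
    exact ⟨hD.block_lt_rev p.1, Finset.mem_Ioo.mp p.2.property⟩
  have hW (a b : Fin m) (h : Matrix.diagonal d a b ≠ 0) :
      D.block a.rev < D.block a ∧ b = a := by
    obtain rfl : a = b := not_imp_comm.mp (fun hab => Matrix.diagonal_apply_ne _ hab) h
    rw [Matrix.diagonal_apply_eq] at h
    obtain ⟨i, rfl⟩ := not_imp_comm.mp (Function.extend_apply' _ (0 : Fin m → R) a) h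
    rw [Fin.rev_rev]
    exact ⟨hD.block_lt_rev i, rfl⟩
  have hWW : ε • ((Matrix.diagonal d).map c).transpose + Matrix.diagonal d = 0 := by
    rw [Matrix.diagonal_map (map_zero c), Matrix.diagonal_transpose, ← Matrix.diagonal_smul,
      Matrix.diagonal_add, Matrix.diagonal_eq_zero]
    ext a
    change ε * c (d a) + d a = 0
    by_cases ha : ∃ i, (D.coordIndex i).rev = a
    · obtain ⟨i, rfl⟩ := ha
      simp only [d, D.rev_coordIndex_injective.extend_apply]
      linear_combination ε * mem_antiHermitian.mp (w i).property - (w i : R) * hD.sq_eq_one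
    · simp [d, Function.extend_apply' _ _ _ ha]
  obtain ⟨X, hX, apply_eq⟩ := hD.exists_mem_nilradical hY hW hWW
  refine ⟨⟨X, hX⟩, Prod.ext (funext fun p => ?_) (funext fun i => Subtype.ext ?_)⟩
  · have hp := Finset.mem_Ioo.mp p.2.property
    exact ((apply_eq _ (hD.block_lt_rev p.1)).1 _ hp.1 hp.2).trans
      (D.position_injective.extend_apply y 0 p)
  · refine (apply_eq _ (hD.block_lt_rev i)).2.trans ?_
    rw [Matrix.diagonal_apply_eq]
    exact D.rev_coordIndex_injective.extend_apply _ _ i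

/-- The nilradical of a quasi-split isometry group in coordinates. -/
def nilradicalEquiv (hD : D.IsQuasiSplit c J ε) : D.nilradical ≃ₗ[k]
    ((Σ i, Finset.Ioo (D.coordIndex i) (D.coordIndex i).rev) → R) × (Fin r → antiHermitian c ε) :=
  .ofBijective hD.nilradicalCoordinates
    ⟨hD.nilradicalCoordinates_injective, hD.nilradicalCoordinates_surjective⟩

theorem torus_apply_eq_zero (hD : D.IsQuasiSplit c J ε) (t : D.torus) {i : Fin r} {l a : Fin m}
    (hl : l ∈ Finset.Ioo (D.coordIndex i) (D.coordIndex i).rev)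
    (ha : a ∉ Finset.Ioo (D.coordIndex i) (D.coordIndex i).rev) : t.val.val.val l a = 0 := by
  refine (t.property l a fun h => ha ?_).1
  rcases hD.eq_or_eq_rev h with rfl | rfl
  · exact hl
  · simpa [Fin.lt_rev_iff, and_comm] using hl

theorem inv_torusEntry_rev (hD : D.IsQuasiSplit c J ε) (t : D.torus) (i : Fin r) :
    (((D.torusEntry (hD.isSingletonBlock_rev i) t)⁻¹ : Rˣ) : R) =
      c (D.torusEntry (hD.hasSingletonBlocks i) t) := by
  rw [Units.val_inv_eq_inv_val]
  exact inv_eq_of_mul_eq_one_left (hD.conj_apply_mul_apply_rev t (hD.block_lt_rev i).ne)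

theorem Ad_apply_inner (hD : D.IsQuasiSplit c J ε) (t : D.torus) (X : D.nilradical) {i : Fin r}
    (l : Finset.Ioo (D.coordIndex i) (D.coordIndex i).rev) :
    (D.Ad t X).val l (D.coordIndex i).rev =
      (c (D.torusEntry (hD.hasSingletonBlocks i) t) • D.innerBlock t i).mulVec
        (fun a => X.val a (D.coordIndex i).rev) l := by
  rw [D.Ad_apply_col t X l (hD.isSingletonBlock_rev i), hD.inv_torusEntry_rev, mul_comm,
    Matrix.smul_mulVec, Pi.smul_apply, smul_eq_mul]
  congr 1
  change _ = ∑ a : Finset.Ioo (D.coordIndex i) (D.coordIndex i).rev,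
    t.val.val.val l a * X.val a (D.coordIndex i).rev
  rw [Finset.sum_coe_sort _ fun a => t.val.val.val l a * X.val a (D.coordIndex i).rev]
  refine (Finset.sum_subset (Finset.subset_univ _) fun a _ ha => ?_).symm
  rw [hD.torus_apply_eq_zero t l.property ha, zero_mul]

theorem Ad_apply_antidiagonal (hD : D.IsQuasiSplit c J ε) (t : D.torus) (X : D.nilradical)
    (i : Fin r) : (D.Ad t X).val (D.coordIndex i) (D.coordIndex i).rev =
      D.torusEntry (hD.hasSingletonBlocks i) t * c (D.torusEntry (hD.hasSingletonBlocks i) t) *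
        X.val (D.coordIndex i) (D.coordIndex i).rev := by
  rw [D.Ad_apply_entry t X (hD.hasSingletonBlocks i) (hD.isSingletonBlock_rev i),
    hD.inv_torusEntry_rev, mul_right_comm]

theorem det_Ad [FiniteDimensional k R] (hD : D.IsQuasiSplit c J ε) (t : D.torus) {s : Fin r → k}
    (hs : ∀ i, algebraMap k R (s i) = D.torusEntry (hD.hasSingletonBlocks i) t *
      c (D.torusEntry (hD.hasSingletonBlocks i) t)) :
    LinearMap.det (D.Ad t) =
      Algebra.norm k (∏ i, (c (D.torusEntry (hD.hasSingletonBlocks i) t) ^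
        (Finset.Ioo (D.coordIndex i) (D.coordIndex i).rev).card * (D.innerBlock t i).det)) *
      ∏ i, s i ^ Module.finrank k (antiHermitian c ε) := by
  let M (i : Fin r) := c (D.torusEntry (hD.hasSingletonBlocks i) t) • D.innerBlock t i
  have action (X : D.nilradical) : hD.nilradicalEquiv (D.Ad t X) =
      ((Matrix.toLin' (Matrix.blockDiagonal' M)).restrictScalars k).prodMap
        (LinearMap.pi fun i => (s i • LinearMap.id) ∘ₗ LinearMap.proj i)
        (hD.nilradicalEquiv X) := by
    refine Prod.ext (funext fun p => ?_) (funext fun i => Subtype.ext ?_)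
    · exact (hD.Ad_apply_inner t X p.2).trans
        (blockDiagonal'_mulVec M (hD.nilradicalCoordinates X).1 p.1 p.2).symm
    · refine (congrArg (_ * ·) (hD.Ad_apply_antidiagonal t X i)).trans ?_
      change _ = s i • (J _ _ * X.val _ _)
      rw [Algebra.smul_def, hs, mul_left_comm]
  rw [det_eq_of_equivariant hD.nilradicalEquiv action, LinearMap.det_prodMap, LinearMap.det_pi,
    LinearMap.det_restrictScalars, LinearMap.det_toLin', det_blockDiagonal']
  simp only [M, Matrix.det_smul, LinearMap.det_smul, LinearMap.det_id, Fintype.card_coe, mul_one]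

end GroupDatum.IsQuasiSplit

end IsometryGroup

section OrthogonalSymplectic

namespace GroupDatum.IsQuasiSplit

variable {k : Type*} [Field k] {m r : ℕ} {D : GroupDatum k k m r}
  {J : Matrix (Fin m) (Fin m) k} {ε : k}

theorem prod_apply_diagonal_notMem_Ioo (hD : D.IsQuasiSplit AlgEquiv.refl J ε) (t : D.torus)
    (i : Fin r) :
    ∏ l : {l // l ∉ Finset.Ioo (D.coordIndex i) (D.coordIndex i).rev}, t.val.val.val l.val l.val =
      1 := by
  refine Finset.prod_involution (fun l _ => ⟨l.val.rev, fun h => l.property ?_⟩)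
    (fun l _ => hD.conj_apply_mul_apply_rev t (hD.block_ne_of_notMem_Ioo l.property))
    (fun l _ _ h => hD.block_ne_of_notMem_Ioo l.property
      (congrArg (fun l => D.block l.val) h).symm)
    (fun _ _ => Finset.mem_univ _) (fun l _ => Subtype.ext (Fin.rev_rev l.val))
  simpa [Fin.lt_rev_iff, Fin.rev_lt_iff, and_comm] using h

theorem det_innerBlock (hD : D.IsQuasiSplit AlgEquiv.refl J ε) (t : D.torus) (i : Fin r) :
    (D.innerBlock t i).det = t.val.val.val.det := by
  have outer : (Matrix.toSquareBlockProp t.val.val.val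
      fun l => l ∉ Finset.Ioo (D.coordIndex i) (D.coordIndex i).rev) =
      Matrix.diagonal fun l => t.val.val.val l.val l.val := by
    ext l a
    rcases eq_or_ne l a with rfl | hla
    · rw [Matrix.diagonal_apply_eq]
      rfl
    · rw [Matrix.diagonal_apply_ne _ hla]
      exact (t.property l a fun h => hla (Subtype.ext
        (hD.isSingletonBlock (hD.block_ne_of_notMem_Ioo l.property) a h.symm).symm)).1
  rw [Matrix.twoBlockTriangular_det' _ (· ∈ Finset.Ioo (D.coordIndex i) (D.coordIndex i).rev)
    fun l hl a ha => hD.torus_apply_eq_zero t hl ha, outer, Matrix.det_diagonal,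
    hD.prod_apply_diagonal_notMem_Ioo, mul_one]
  congr!

variable [ValuativeRel k] [TopologicalSpace k] [IsNonarchimedeanLocalField k]

theorem det_Ad_mul_torusProd_pow_mem_evenOrd (hD : D.IsQuasiSplit AlgEquiv.refl J ε) (t : D.torus)
    (ht : t.val.val.val.det ∈ evenOrd k) :
    LinearMap.det (D.Ad t) * (D.torusProd hD.hasSingletonBlocks t : k) ^ m ∈ evenOrd k := by
  have card_add (i : Fin r) :
      Even ((Finset.Ioo (D.coordIndex i) (D.coordIndex i).rev).card + m) := by
    have lt_rev : D.coordIndex i < (D.coordIndex i).rev :=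
      hD.monotone_block.reflect_lt (hD.block_lt_rev i)
    rw [Fin.card_Ioo]
    rw [Fin.lt_def, Fin.val_rev] at lt_rev
    rw [Fin.val_rev, Nat.even_iff]
    omega
  have even_pow (x : k) {a : ℕ} (ha : Even a) : x ^ a ∈ evenOrd k := by
    obtain ⟨b, rfl⟩ := even_iff_exists_two_mul.mp ha
    exact pow_mul' x 2 b ▸ sq_mem_evenOrd _
  rw [hD.det_Ad t (s := fun i => D.torusEntry (hD.hasSingletonBlocks i) t ^ 2)
    fun i => sq (D.torusEntry (hD.hasSingletonBlocks i) t : k), Algebra.norm_self,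
    MonoidHom.id_apply, D.torusProd_apply, Units.coe_prod, ← Finset.prod_pow, mul_right_comm,
    ← Finset.prod_mul_distrib]
  refine mul_mem (prod_mem fun i _ => ?_) (prod_mem fun i _ => ?_)
  · rw [hD.det_innerBlock, AlgEquiv.coe_refl, id_eq, mul_right_comm, ← pow_add]
    exact mul_mem (even_pow _ (card_add i)) ht
  · exact pow_mem (sq_mem_evenOrd _) _

theorem isModulusSign (hD : D.IsQuasiSplit AlgEquiv.refl J ε) (s : ℤˣ)
    (hdet : ∀ g ∈ D.group, g.val.det ∈ evenOrd k) : D.IsModulusSign s 1 (s ^ m) where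
  singleton := hD.hasSingletonBlocks
  isOpen := by simp
  integral _ _ := rfl
  unipotent _ _ := rfl
  sign_det_Ad t := by
    rw [sign_zpow_ord_congr s (D.det_Ad_ne_zero t) (pow_ne_zero m (Units.ne_zero _))
      (hD.det_Ad_mul_torusProd_pow_mem_evenOrd t (hdet _ t.val.property)), MonoidHom.one_apply,
      one_mul, unramifiedSign_apply, ← Units.val_pow_eq_pow_val, ← unramifiedSign_apply, map_pow,
      unramifiedSign_apply, ← zpow_natCast, ← zpow_mul, ← zpow_natCast, ← zpow_mul, mul_comm]

end GroupDatum.IsQuasiSplit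

end OrthogonalSymplectic

section UnramifiedNorm

theorem residue_eq_iff {F : Type*} [Field F] [ValuativeRel F] {x y : 𝒪[F]} :
    IsLocalRing.residue 𝒪[F] x = IsLocalRing.residue 𝒪[F] y ↔
      valuation F (x.val - y.val) < 1 := by
  rw [← sub_eq_zero, ← map_sub, IsLocalRing.residue_eq_zero_iff, IsLocalRing.mem_maximalIdeal,
    mem_nonunits_iff]
  exact Valuation.Integer.not_isUnit_iff_valuation_lt_one

variable {k E : Type*} [Field k] [Field E] [ValuativeRel E] [Algebra k E]

/-- The valuation of `E` is the maximum of the valuations of the coordinates in the basis `B`: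
the integers of `E` are a free module with basis `B` over those of `k`, and the two valuations
have the same values. -/
def IsValuationOrthonormal {ι : Type*} (B : Module.Basis ι k E) : Prop :=
  ∀ y, IsGreatest (Set.range fun i => valuation E (algebraMap k E (B.repr y i))) (valuation E y)

theorem IsValuationOrthonormal.valuation_le_one {ι : Type*} {B : Module.Basis ι k E}
    (hB : IsValuationOrthonormal B) (i : ι) : valuation E (B i) ≤ 1 := by
  classical
  obtain ⟨j, hj⟩ := (hB (B i)).1
  rw [← hj]
  dsimp only
  rw [B.repr_self_apply]
  split_ifs <;> simp

variable [ValuativeRel k] [ValuativeExtension k E]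

theorem valuation_algebraMap_le_one_iff {a : k} :
    valuation E (algebraMap k E a) ≤ 1 ↔ valuation k a ≤ 1 := by
  rw [← ValuativeExtension.mapValueGroupWithZero_valuation,
    ← map_one (ValuativeExtension.mapValueGroupWithZero k E)]
  exact ValuativeExtension.mapValueGroupWithZero_strictMono.le_iff_le

theorem valuation_algebraMap_lt_one_iff {a : k} :
    valuation E (algebraMap k E a) < 1 ↔ valuation k a < 1 := by
  rw [← ValuativeExtension.mapValueGroupWithZero_valuation,
    ← map_one (ValuativeExtension.mapValueGroupWithZero k E)]
  exact ValuativeExtension.mapValueGroupWithZero_strictMono.lt_iff_lt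

theorem exists_forall_valuation_sub_eq_one [Finite 𝓀[k]] (h : Nat.card 𝓀[k] < Nat.card 𝓀[E]) :
    ∃ ω : E, ∀ a : k, valuation k a ≤ 1 → valuation E (ω - algebraMap k E a) = 1 := by
  choose lift residue_lift using IsLocalRing.residue_surjective (R := 𝒪[k])
  let f (x : 𝓀[k]) : 𝓀[E] := IsLocalRing.residue 𝒪[E]
    ⟨algebraMap k E (lift x), valuation_algebraMap_le_one_iff.mpr (lift x).property⟩
  obtain ⟨y, hy⟩ := not_forall.mp fun hf => (Nat.card_le_card_of_surjective f hf).not_gt h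
  obtain ⟨ω, rfl⟩ := IsLocalRing.residue_surjective y
  refine ⟨ω.val, fun a ha => ?_⟩
  have le_one : valuation E (ω.val - algebraMap k E a) ≤ 1 :=
    (valuation E).map_sub_le ω.property (valuation_algebraMap_le_one_iff.mpr ha)
  refine le_one.eq_of_not_lt fun lt_one => hy ⟨IsLocalRing.residue 𝒪[k] ⟨a, ha⟩, ?_⟩
  have lift_sub := valuation_algebraMap_lt_one_iff (E := E).mpr
    (residue_eq_iff.mp (residue_lift (IsLocalRing.residue 𝒪[k] ⟨a, ha⟩)))
  rw [map_sub] at lift_sub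
  rw [residue_eq_iff, ← sub_sub_sub_cancel_right _ _ (algebraMap k E a)]
  exact (valuation E).map_sub_lt lift_sub lt_one

theorem valuation_add_mul {ω : E}
    (hω : ∀ a : k, valuation k a ≤ 1 → valuation E (ω - algebraMap k E a) = 1) (a b : k) :
    valuation E (algebraMap k E a + algebraMap k E b * ω) =
      max (valuation E (algebraMap k E a)) (valuation E (algebraMap k E b)) := by
  have valuation_ω : valuation E ω = 1 := by simpa using hω 0 (by simp)
  have sub_eq_max (c : k) :
      valuation E (ω - algebraMap k E c) = max (valuation E (algebraMap k E c)) 1 := by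
    rcases le_or_gt (valuation E (algebraMap k E c)) 1 with hc | hc
    · rw [max_eq_right hc, hω c (valuation_algebraMap_le_one_iff.mp hc)]
    · rw [max_eq_left hc.le, Valuation.map_sub_eq_of_lt_right _ (by rwa [valuation_ω])]
  rcases eq_or_ne b 0 with rfl | hb
  · simp
  have hbE : algebraMap k E b ≠ 0 := by simpa using hb
  have factor : algebraMap k E a + algebraMap k E b * ω =
      (ω - algebraMap k E (-(a / b))) * algebraMap k E b := by
    rw [map_neg, map_div₀, sub_neg_eq_add, add_mul, div_mul_cancel₀ _ hbE, add_comm, mul_comm ω]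
  rw [factor, map_mul, sub_eq_max, ← max_mul_mul_right, one_mul, ← map_mul, map_neg,
    map_div₀, neg_mul, div_mul_cancel₀ _ hbE, Valuation.map_neg]

theorem exists_isValuationOrthonormal [Finite 𝓀[k]] (hfin : Module.finrank k E = 2)
    (hcard : Nat.card 𝓀[k] < Nat.card 𝓀[E]) :
    ∃ B : Module.Basis (Fin 2) k E, IsValuationOrthonormal B := by
  obtain ⟨ω, hω⟩ := exists_forall_valuation_sub_eq_one hcard
  have independent : LinearIndependent k ![1, ω] := by
    refine LinearIndependent.pair_iff.mpr fun a b hab => ?_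
    have h := valuation_add_mul hω a b
    rw [← mul_one (algebraMap k E a), ← Algebra.smul_def, ← Algebra.smul_def, hab, map_zero,
      eq_comm, ← le_zero_iff, max_le_iff] at h
    simpa using h
  refine ⟨basisOfLinearIndependentOfCardEqFinrank independent (by simp [hfin]), fun y => ?_⟩
  set B := basisOfLinearIndependentOfCardEqFinrank independent _
  have valuation_eq := valuation_add_mul hω (B.repr y 0) (B.repr y 1)
  have expansion : algebraMap k E (B.repr y 0) + algebraMap k E (B.repr y 1) * ω = y := by
    simpa [B, Fin.sum_univ_two, Algebra.smul_def] using B.sum_repr y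
  rw [expansion] at valuation_eq
  rw [valuation_eq]
  refine ⟨?_, ?_⟩
  · rcases max_choice (valuation E (algebraMap k E (B.repr y 0)))
      (valuation E (algebraMap k E (B.repr y 1))) with h | h
    · exact ⟨0, h.symm⟩
    · exact ⟨1, h.symm⟩
  · rintro _ ⟨i, rfl⟩
    fin_cases i
    · exact le_max_left _ _
    · exact le_max_right _ _

namespace IsValuationOrthonormal

variable {ι : Type*} {B : Module.Basis ι k E}

theorem repr_mem_integer (hB : IsValuationOrthonormal B) {y : E} (hy : valuation E y ≤ 1) (i : ι) :
    B.repr y i ∈ 𝒪[k] :=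
  valuation_algebraMap_le_one_iff.mp (((hB y).2 ⟨i, rfl⟩).trans hy)

theorem norm_mem_integer [Finite ι] (hB : IsValuationOrthonormal B) {y : E}
    (hy : valuation E y ≤ 1) : Algebra.norm k y ∈ 𝒪[k] := by
  classical
  cases nonempty_fintype ι
  rw [Algebra.norm_eq_matrix_det B]
  refine det_mem_integer fun i j => ?_
  rw [Algebra.leftMulMatrix_eq_repr_mul]
  refine hB.repr_mem_integer ?_ i
  rw [map_mul]
  exact mul_le_one' hy (hB.valuation_le_one j)

variable [TopologicalSpace k] [IsNonarchimedeanLocalField k]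

theorem ord_norm_eq_zero [Finite ι] (hB : IsValuationOrthonormal B) {u : E}
    (hu : valuation E u = 1) : ord k (Algebra.norm k u) = 0 := by
  have hu0 : u ≠ 0 := (valuation E).ne_zero_iff.mp (hu ▸ one_ne_zero)
  refine ord_eq_zero_of_mul_eq_one (hB.norm_mem_integer hu.le)
    (hB.norm_mem_integer (y := u⁻¹) (by rw [map_inv₀, hu, inv_one])) ?_
  rw [← map_mul, mul_inv_cancel₀ hu0, map_one]

theorem exists_ord_norm_eq [Finite ι] (hB : IsValuationOrthonormal B) {x : E} (hx : x ≠ 0) :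
    ∃ z : k, ord k (Algebra.norm k x) = ord k (z ^ Module.finrank k E) := by
  have := Module.Basis.finiteDimensional_of_finite B
  obtain ⟨z, hz⟩ : ∃ z : k, valuation E (algebraMap k E z) = valuation E x :=
    let ⟨_, h⟩ := (hB x).1
    ⟨_, h⟩
  have hz0 : algebraMap k E z ≠ 0 := by
    rwa [← (valuation E).ne_zero_iff, hz, (valuation E).ne_zero_iff]
  have unit : valuation E (x / algebraMap k E z) = 1 := by
    rw [map_div₀, hz, div_self ((valuation E).ne_zero_iff.mpr hx)]
  refine ⟨z, ?_⟩
  rw [← div_mul_cancel₀ x hz0, map_mul, ord_mul (Algebra.norm_ne_zero_iff.mpr (div_ne_zero hx hz0))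
    (Algebra.norm_ne_zero_iff.mpr hz0), hB.ord_norm_eq_zero unit, zero_add, Algebra.norm_algebraMap]

end IsValuationOrthonormal

theorem norm_mem_evenOrd [TopologicalSpace k] [IsNonarchimedeanLocalField k]
    (hfin : Module.finrank k E = 2) (hcard : Nat.card 𝓀[k] < Nat.card 𝓀[E]) (x : E) :
    Algebra.norm k x ∈ evenOrd k := by
  have : FiniteDimensional k E := FiniteDimensional.of_finrank_eq_succ hfin
  rcases eq_or_ne x 0 with rfl | hx
  · simp [mem_evenOrd, ord_zero]
  obtain ⟨B, hB⟩ := exists_isValuationOrthonormal hfin hcard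
  obtain ⟨z, hz⟩ := hB.exists_ord_norm_eq hx
  rw [mem_evenOrd, hz, hfin]
  exact sq_mem_evenOrd z

end UnramifiedNorm

section Unitary

variable {k E : Type*} [Field k] [Field E] [Algebra k E] {c : E ≃ₐ[k] E}

theorem algebraMap_norm_eq_mul_conj (hfin : Module.finrank k E = 2) (hc : c ≠ AlgEquiv.refl)
    (x : E) : algebraMap k E (Algebra.norm k x) = x * c x := by
  classical
  have : FiniteDimensional k E := FiniteDimensional.of_finrank_eq_succ hfin
  have card_le : Fintype.card (E ≃ₐ[k] E) ≤ 2 := hfin ▸ AlgEquiv.card_le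
  have univ_eq : {AlgEquiv.refl, c} = (Finset.univ : Finset (E ≃ₐ[k] E)) :=
    Finset.eq_univ_of_card _ (le_antisymm (Finset.card_le_univ _)
      (card_le.trans (Finset.card_pair hc.symm).ge))
  have : IsGalois k E := IsGalois.of_card_aut_eq_finrank _ _ <| by
    rw [Nat.card_eq_fintype_card, hfin, ← Finset.card_univ, ← univ_eq, Finset.card_pair hc.symm]
  rw [Algebra.norm_eq_prod_automorphisms, ← univ_eq, Finset.prod_pair hc.symm, AlgEquiv.coe_refl,
    id_eq]

theorem conj_conj (hfin : Module.finrank k E = 2) (hc : c ≠ AlgEquiv.refl) (x : E) :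
    c (c x) = x := by
  rcases eq_or_ne x 0 with rfl | hx
  · simp
  have h := congrArg c (algebraMap_norm_eq_mul_conj hfin hc x)
  rw [AlgEquiv.commutes, algebraMap_norm_eq_mul_conj hfin hc, map_mul, mul_comm] at h
  exact (mul_left_cancel₀ ((map_ne_zero c).mpr hx) h).symm

theorem GroupDatum.IsQuasiSplit.isModulusSign_one {m r : ℕ} {D : GroupDatum k E m r}
    {J : Matrix (Fin m) (Fin m) E} {ε : E} [ValuativeRel k] [TopologicalSpace k]
    [IsNonarchimedeanLocalField k] [ValuativeRel E] [TopologicalSpace E]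
    [IsNonarchimedeanLocalField E] [ValuativeExtension k E]
    (hD : D.IsQuasiSplit c J ε) (s : ℤˣ) (hfin : Module.finrank k E = 2)
    (hcard : Nat.card 𝓀[k] < Nat.card 𝓀[E]) (hc : c ≠ AlgEquiv.refl) :
    D.IsModulusSign s 1 1 where
  singleton := hD.hasSingletonBlocks
  isOpen := by simp
  integral _ _ := rfl
  unipotent _ _ := rfl
  sign_det_Ad t := by
    have : FiniteDimensional k E := FiniteDimensional.of_finrank_eq_succ hfin
    have norm_mem := norm_mem_evenOrd (k := k) (E := E) hfin hcard
    rw [unramifiedSign_one, MonoidHom.one_apply, MonoidHom.one_apply, one_mul]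
    refine sign_zpow_ord_of_mem_evenOrd s ?_
    rw [hD.det_Ad t fun i => algebraMap_norm_eq_mul_conj hfin hc _]
    exact mul_mem (norm_mem _) (prod_mem fun i _ => pow_mem (norm_mem _) _)

end Unitary

section ClassicalGroups

theorem GroupDatum.isQuasiSplit_of_antidiagonal {k R : Type*} [Field k] [Field R] [Algebra k R]
    {m r : ℕ} {D : GroupDatum k R m r} {c : R ≃ₐ[k] R} {J : Matrix (Fin m) (Fin m) R} {ε : R}
    (group_le : D.group ≤ isometryGroup c J) (lie_eq : D.lie = isometryLie c J)
    (block_apply : ∀ i, D.block i = i) (hr : r = m / 2)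
    (antidiagonal : ∀ i j, j ≠ i.rev → J i j = 0) (ne_zero : ∀ i, i ≠ i.rev → J i i.rev ≠ 0)
    (hermitian : ∀ i, c (J i.rev i) = ε * J i i.rev) (hε : ε * ε = 1) (hc : ∀ x, c (c x) = x) :
    D.IsQuasiSplit c J ε where
  group_le := group_le
  lie_eq := lie_eq
  monotone_block i j hij := by simpa only [block_apply, Fin.val_fin_le] using hij
  eq_or_eq_rev {i j} h := by
    rw [block_apply, block_apply] at h
    exact .inl (Fin.ext h.symm)
  isotropic_iff i := by
    rw [block_apply, block_apply, Fin.val_rev]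
    omega
  gram_eq_zero {i j} h := antidiagonal i j fun hj => h (by rw [hj])
  gram_ne_zero {i} h := ne_zero i fun hi => h (congrArg D.block hi)
  gram_conj i j := by
    rcases eq_or_ne j i.rev with rfl | hj
    · exact hermitian i
    · rw [antidiagonal i j hj, antidiagonal j i fun hi => hj (by rw [hi, Fin.rev_rev]), map_zero,
        mul_zero]
  sq_eq_one := hε
  conj_conj := hc

variable {k : Type*} [Field k]

theorem soOdd_isQuasiSplit (n : ℕ) :
    (soOdd k n).IsQuasiSplit AlgEquiv.refl (gramOdd k n) 1 := by
  have middle_iff (i : Fin (2 * n + 1)) : (i.rev : ℕ) = n ↔ (i : ℕ) = n := by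
    rw [Fin.val_rev]
    omega
  refine GroupDatum.isQuasiSplit_of_antidiagonal inf_le_left rfl (fun _ => rfl) (by omega)
    (fun i j h => if_neg h) (fun i hi => ?_) (fun i => ?_) (one_mul 1) fun _ => rfl
  · have not_middle : (i : ℕ) ≠ n := fun h => hi (Fin.ext (h.trans ((middle_iff i).mpr h).symm))
    simp [gramOdd, not_middle]
  · simp only [gramOdd, middle_iff, Fin.rev_rev, if_true, one_mul, AlgEquiv.coe_refl, id_eq]

theorem sp_isQuasiSplit (n : ℕ) :
    (sp k n).IsQuasiSplit AlgEquiv.refl (gramSymplectic k n) (-1) := by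
  refine GroupDatum.isQuasiSplit_of_antidiagonal le_rfl rfl (fun _ => rfl) (by omega)
    (fun i j h => if_neg h) (fun i _ => ?_) (fun i => ?_) (by simp) fun _ => rfl
  · simp only [gramSymplectic, if_true]
    split_ifs <;> simp
  · have upper_iff : (i.rev : ℕ) < n ↔ ¬(i : ℕ) < n := by
      rw [Fin.val_rev]
      omega
    by_cases hi : (i : ℕ) < n <;> simp [gramSymplectic, upper_iff, hi, -Fin.val_rev]

theorem unitaryU_isQuasiSplit {E : Type*} [Field E] [Algebra k E] {c : E ≃ₐ[k] E}
    (hc : ∀ x, c (c x) = x) (n : ℕ) : (unitaryU c n).IsQuasiSplit c (gramSplit E n) 1 :=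
  GroupDatum.isQuasiSplit_of_antidiagonal le_rfl rfl (fun _ => rfl) rfl (fun _ _ h => if_neg h)
    (fun i _ => by simp [gramSplit]) (fun i => by simp [gramSplit]) (one_mul 1) hc

theorem soEvenSplit_isQuasiSplit (n : ℕ) :
    (soEvenSplit k n).IsQuasiSplit AlgEquiv.refl (gramSplit k (2 * n)) 1 :=
  GroupDatum.isQuasiSplit_of_antidiagonal inf_le_left rfl (fun _ => rfl) (by omega)
    (fun _ _ h => if_neg h) (fun i _ => by simp [gramSplit]) (fun i => by simp [gramSplit])
    (one_mul 1) fun _ => rfl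

theorem gramNonsplit_symm (n : ℕ) (a b : k) (i j : Fin (2 * n)) :
    gramNonsplit k n a b j i = gramNonsplit k n a b i j := by
  rcases eq_or_ne j i with rfl | hij
  · rfl
  by_cases hj : j = i.rev
  · subst hj
    have middle_iff : (i.rev : ℕ) + 1 = n ∨ (i.rev : ℕ) = n ↔ (i : ℕ) + 1 = n ∨ (i : ℕ) = n := by
      rw [Fin.val_rev]
      omega
    simp [gramNonsplit, hij, hij.symm, middle_iff, -Fin.val_rev]
  · have hi : i ≠ j.rev := fun h => hj (by rw [h, Fin.rev_rev])
    simp [gramNonsplit, hij, hij.symm, hi, hj]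

theorem soEvenNonsplit_isQuasiSplit (n : ℕ) (a b : k) :
    (soEvenNonsplit k n a b).IsQuasiSplit AlgEquiv.refl (gramNonsplit k n a b) 1 := by
  have block_apply (i : Fin (2 * n)) :
      (soEvenNonsplit k n a b).block i = if (i : ℕ) = n then n - 1 else (i : ℕ) := rfl
  refine ⟨inf_le_left, rfl, fun i j hij => ?_, fun {i j} h => ?_, fun i => ?_, fun {i j} h => ?_,
    fun {i} h => ?_, fun i j => ?_, one_mul 1, fun _ => rfl⟩
  · rw [Fin.le_def] at hij
    rw [block_apply, block_apply]
    split_ifs <;> omega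
  · rw [block_apply, block_apply] at h
    rw [Fin.ext_iff, Fin.ext_iff, Fin.val_rev]
    split_ifs at h <;> omega
  · rw [block_apply, block_apply, Fin.val_rev]
    split_ifs <;> omega
  · rw [block_apply, block_apply, Fin.val_rev] at h
    rw [gramNonsplit, if_neg, if_neg, if_neg]
    all_goals
      simp only [Fin.ext_iff, Fin.val_rev]
      split_ifs at h <;> omega
  · rw [block_apply, block_apply, Fin.val_rev] at h
    have not_middle : (i : ℕ) + 1 ≠ n ∧ (i : ℕ) ≠ n := by
      split_ifs at h <;> omega
    simp [gramNonsplit, not_middle.1, not_middle.2]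
  · rw [one_mul]
    exact gramNonsplit_symm n a b i j

theorem isUnit_det_gramSymplectic (n : ℕ) : IsUnit (gramSymplectic k n).det := by
  refine Matrix.isUnit_det_of_left_inverse (B := -gramSymplectic k n) ?_
  ext i j
  have upper_iff : (i.rev : ℕ) < n ↔ ¬(i : ℕ) < n := by
    rw [Fin.val_rev]
    omega
  rw [Matrix.mul_apply, Finset.sum_eq_single i.rev (fun l _ hl => ?_) (by simp)]
  · rw [Matrix.one_apply]
    by_cases hi : (i : ℕ) < n <;>
      simp [gramSymplectic, upper_iff, hi, eq_comm (a := i), -Fin.val_rev]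
  · rw [Matrix.neg_apply, gramSymplectic, if_neg hl, neg_zero, zero_mul]

theorem det_mul_self_of_mem_isometryGroup {m : ℕ} {J : Matrix (Fin m) (Fin m) k}
    (hJ : IsUnit J.det) {g : GL (Fin m) k} (hg : g ∈ isometryGroup (AlgEquiv.refl : k ≃ₐ[k] k) J) :
    g.val.det * g.val.det = 1 := by
  have h := congrArg Matrix.det (hg : (g.val.map AlgEquiv.refl).transpose * J * g.val = J)
  rw [AlgEquiv.coe_refl, Matrix.map_id, Matrix.det_mul, Matrix.det_mul, Matrix.det_transpose] at h
  exact hJ.mul_right_cancel (by linear_combination h)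

variable [ValuativeRel k] [TopologicalSpace k] [IsNonarchimedeanLocalField k]

theorem det_mem_evenOrd_of_mem_detOne {m : ℕ} {g : GL (Fin m) k} (hg : g ∈ detOne k m) :
    g.val.det ∈ evenOrd k := by
  rw [show g.val.det = 1 from congrArg Units.val (hg : Matrix.GeneralLinearGroup.det g = 1)]
  exact one_mem _

theorem det_mem_evenOrd_of_mem_sp {n : ℕ} {g : GL (Fin (2 * n)) k} (hg : g ∈ (sp k n).group) :
    g.val.det ∈ evenOrd k := by
  have det_mul_self := det_mul_self_of_mem_isometryGroup (isUnit_det_gramSymplectic n) hg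
  have det_ne_zero := left_ne_zero_of_mul_eq_one det_mul_self
  have ord_eq := congrArg (ord k) det_mul_self
  rw [ord_mul det_ne_zero det_ne_zero, ord_one] at ord_eq
  rw [mem_evenOrd, show ord k g.val.det = 0 by omega]
  exact Even.zero

end ClassicalGroups

section DualGroup

theorem complexSign_inv (ε : ℤˣ) : (complexSign ε)⁻¹ = complexSign ε := by
  rw [← map_inv, Int.units_inv_eq_self]

theorem dualTorus_map {r : ℕ} (N : ℕ) (σ : ℂ ≃+* ℂ) (α : Fin r → ℂˣ) :
    dualTorus N (fun i => Units.map (σ : ℂ →* ℂ) (α i)) = (dualTorus N α).map σ := by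
  rw [dualTorus, dualTorus, Matrix.diagonal_map (map_zero σ)]
  congr 1
  ext i
  split_ifs <;> simp

theorem dualTorus_sign_mul (n : ℕ) (ε : ℤˣ) (α : Fin n → ℂˣ) :
    dualTorus (2 * n) (fun i => complexSign ε * α i) = ε • dualTorus (2 * n) α := by
  ext i j
  rw [dualTorus, dualTorus, Matrix.smul_apply, sign_smul]
  rcases eq_or_ne i j with rfl | hij
  · rw [Matrix.diagonal_apply_eq, Matrix.diagonal_apply_eq]
    split_ifs with h h'
    · rw [Units.val_mul]
    · rw [mul_inv, complexSign_inv, Units.val_mul]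
    · rw [Fin.val_rev] at h'
      omega
  · rw [Matrix.diagonal_apply_ne _ hij, Matrix.diagonal_apply_ne _ hij, mul_zero]

theorem frobeniusSwap_map (n : ℕ) (σ : ℂ ≃+* ℂ) : (frobeniusSwap n).map σ = frobeniusSwap n := by
  ext i j
  simp only [Matrix.map_apply, frobeniusSwap]
  split_ifs <;> simp

theorem gramSplit_map (n : ℕ) (σ : ℂ ≃+* ℂ) : (gramSplit ℂ n).map σ = gramSplit ℂ n := by
  ext i j
  simp only [Matrix.map_apply, gramSplit]
  split_ifs <;> simp

theorem halfTorus_map {r : ℕ} (n : ℕ) (σ : ℂ ≃+* ℂ) (α : Fin r → ℂˣ) :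
    halfTorus n (fun i => Units.map (σ : ℂ →* ℂ) (α i)) = (halfTorus n α).map σ := by
  rw [halfTorus, halfTorus, Matrix.diagonal_map (map_zero σ)]
  congr 1
  ext i
  split_ifs <;> simp

theorem matrix_inv_map {n K : Type*} [Fintype n] [DecidableEq n] [Field K] (σ : K ≃+* K)
    (A : Matrix n n K) : A⁻¹.map σ = (A.map σ)⁻¹ := by
  have det_map : (A.map σ).det = σ A.det := (RingHom.map_det (σ : K →+* K) A).symm
  have adjugate_map : (A.map σ).adjugate = A.adjugate.map σ :=
    (RingHom.map_adjugate (σ : K →+* K) A).symm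
  rw [Matrix.inv_def, Matrix.inv_def, det_map, adjugate_map, Ring.inverse_eq_inv', ← map_inv₀]
  ext i j
  simp

theorem unitaryFrobenius_map (n : ℕ) (σ : ℂ ≃+* ℂ) (t : Matrix (Fin n) (Fin n) ℂ) :
    unitaryFrobenius n (t.map σ) = (unitaryFrobenius n t).map σ := by
  rw [unitaryFrobenius, unitaryFrobenius, Matrix.map_mul, Matrix.map_mul, matrix_inv_map,
    gramSplit_map, Matrix.transpose_map, matrix_inv_map]

end DualGroup

section Transfer

variable {k : Type*} [Field k] [ValuativeRel k] [TopologicalSpace k]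
  [IsNonarchimedeanLocalField k] (σ : ℂ ≃+* ℂ) {V W : Type*} [AddCommGroup V] [Module ℂ V]
  [AddCommGroup W] [Module ℂ W]

theorem sign_pow_two_mul (s : ℤˣ) (n : ℕ) : s ^ (2 * n) = 1 := by
  rw [pow_mul, Int.units_sq, one_pow]

theorem sign_pow_two_mul_add_one (s : ℤˣ) (n : ℕ) : s ^ (2 * n + 1) = s := by
  rw [pow_succ, sign_pow_two_mul, one_mul]

theorem gl_isModulusSign_one {F : Type*} [Field F] [ValuativeRel F] [TopologicalSpace F]
    [IsNonarchimedeanLocalField F] {N : ℕ} {s ε : ℤˣ} (h : ε = s ^ (N + 1)) :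
    (gl F N).IsModulusSign s 1 ε := by
  have ordDetCharacter_one : ordDetCharacter F N 1 = 1 := by
    rw [ordDetCharacter, unramifiedSign_one, MonoidHom.one_comp]
  exact ordDetCharacter_one ▸ gl_isModulusSign (by rw [one_mul, h])

theorem transferSOOdd_conjRep_iff (n : ℕ) (π : Representation ℂ (soOdd k n).group V)
    (Pi : Representation ℂ (gl k (2 * n)).group W) :
    transferSOOdd k n π Pi ↔ transferSOOdd k n (conjRep σ π) (conjRep σ Pi) := by
  refine ((soOdd_isQuasiSplit n).isModulusSign _
    fun _ hg => det_mem_evenOrd_of_mem_detOne hg.2).isTransfer_iff (gl_isModulusSign_one rfl)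
    (fun τ α => ?_) (.conj σ π) (.conj σ Pi)
  rw [dualTorus_sign_mul, dualTorus_map]

theorem transferSp_conjRep_iff (n : ℕ) (π : Representation ℂ (sp k n).group V)
    (Pi : Representation ℂ (gl k (2 * n + 1)).group W) :
    transferSp k n π Pi ↔ transferSp k n (conjRep σ π) (conjRep σ Pi) := by
  refine ((sp_isQuasiSplit n).isModulusSign _ fun _ => det_mem_evenOrd_of_mem_sp).isTransfer_iff
    (gl_isModulusSign_one (ε := 1) (sign_pow_two_mul _ (n + 1)).symm) (fun τ α => ?_) (.conj σ π)
    (.conj σ Pi)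
  simp only [sign_pow_two_mul, map_one, one_mul, one_smul, dualTorus_map]

theorem transferUnitary_conjRep_iff {E : Type*} [Field E] [ValuativeRel E] [TopologicalSpace E]
    [IsNonarchimedeanLocalField E] [Algebra k E] [ValuativeExtension k E] {c : E ≃ₐ[k] E}
    (hfin : Module.finrank k E = 2) (hcard : Nat.card 𝓀[E] = Nat.card 𝓀[k] ^ 2)
    (hc : c ≠ AlgEquiv.refl) (n : ℕ) (π : Representation ℂ (unitaryU c n).group V)
    (Pi : Representation ℂ (gl E n).group W) :
    transferUnitary c n π Pi ↔ transferUnitary c n (conjRep σ π) (conjRep σ Pi) := by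
  have card_lt : Nat.card 𝓀[k] < Nat.card 𝓀[E] :=
    hcard ▸ lt_self_pow₀ Finite.one_lt_card one_lt_two
  refine ((unitaryU_isQuasiSplit (conj_conj hfin hc) n).isModulusSign_one _ hfin card_lt
    hc).isTransfer_iff (gl_isModulusSign_one (ε := 1) ?_) (fun τ α => ?_) (.conj σ π) (.conj σ Pi)
  · rw [hcard, sqrtSign_sq, one_pow]
  · simp only [map_one, one_mul, one_smul, halfTorus_map, unitaryFrobenius_map, Matrix.map_mul]

theorem gl_isModulusSign_ordDetCharacter (s : ℤˣ) (n : ℕ) :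
    (gl k (2 * n)).IsModulusSign s (ordDetCharacter k (2 * n) s) 1 :=
  gl_isModulusSign (by rw [mul_one, sign_pow_two_mul_add_one])

theorem transferSOEvenSplit_conjRep_iff (n : ℕ) (π : Representation ℂ (soEvenSplit k n).group V)
    (Pi : Representation ℂ (gl k (2 * n)).group W) :
    transferSOEvenSplit k n π Pi ↔ transferSOEvenSplit k n (conjRep σ π)
      (twist (absDet k (2 * n) (1 / 2)) (conjRep σ (twist (absDet k (2 * n) (-(1 / 2))) Pi))) := by
  refine ((soEvenSplit_isQuasiSplit n).isModulusSign _
    fun _ hg => det_mem_evenOrd_of_mem_detOne hg.2).isTransfer_iff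
    (gl_isModulusSign_ordDetCharacter _ n) (fun τ α => ?_) (.conj σ π) (.absDetTwist σ Pi)
  simp only [sign_pow_two_mul, map_one, one_mul, one_smul, dualTorus_map]

theorem transferSOEvenNonsplit_conjRep_iff (n : ℕ) (a b : k)
    (π : Representation ℂ (soEvenNonsplit k n a b).group V)
    (Pi : Representation ℂ (gl k (2 * n)).group W) :
    transferSOEvenNonsplit k n a b π Pi ↔ transferSOEvenNonsplit k n a b (conjRep σ π)
      (twist (absDet k (2 * n) (1 / 2)) (conjRep σ (twist (absDet k (2 * n) (-(1 / 2))) Pi))) := by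
  refine ((soEvenNonsplit_isQuasiSplit n a b).isModulusSign _
    fun _ hg => det_mem_evenOrd_of_mem_detOne hg.2).isTransfer_iff
    (gl_isModulusSign_ordDetCharacter _ n) (fun τ α => ?_) (.conj σ π) (.absDetTwist σ Pi)
  simp only [sign_pow_two_mul, map_one, one_mul, one_smul, dualTorus_map, Matrix.map_mul,
    frobeniusSwap_map]

end Transfer

end UnramTransfer

end

theorem lemma9p2_general {k : Type*} [Field k] [ValuativeRel k] [TopologicalSpace k]
    [IsNonarchimedeanLocalField k] (σ : ℂ ≃+* ℂ)
    {V : Type*} [AddCommGroup V] [Module ℂ V] {W : Type*} [AddCommGroup W] [Module ℂ W] :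
    (∀ (n : ℕ) (π : Representation ℂ (soOdd k n).group V), (soOdd k n).IsUnramified π →
      (soOdd k n).IsUnramified (conjRep σ π) ∧
      ∀ Pi : Representation ℂ (gl k (2 * n)).group W,
        transferSOOdd k n π Pi ↔ transferSOOdd k n (conjRep σ π) (conjRep σ Pi)) ∧
    (∀ (n : ℕ) (π : Representation ℂ (sp k n).group V), (sp k n).IsUnramified π →
      (sp k n).IsUnramified (conjRep σ π) ∧
      ∀ Pi : Representation ℂ (gl k (2 * n + 1)).group W,
        transferSp k n π Pi ↔ transferSp k n (conjRep σ π) (conjRep σ Pi)) ∧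
    (∀ (E : Type*) [Field E] [ValuativeRel E] [TopologicalSpace E] [IsNonarchimedeanLocalField E]
      [Algebra k E] [ValuativeExtension k E] (c : E ≃ₐ[k] E),
      Module.finrank k E = 2 → Nat.card 𝓀[E] = Nat.card 𝓀[k] ^ 2 → c ≠ AlgEquiv.refl →
      ∀ (n : ℕ) (π : Representation ℂ (unitaryU c n).group V), (unitaryU c n).IsUnramified π →
      (unitaryU c n).IsUnramified (conjRep σ π) ∧
      ∀ Pi : Representation ℂ (gl E n).group W,
        transferUnitary c n π Pi ↔ transferUnitary c n (conjRep σ π) (conjRep σ Pi)) ∧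
    (∀ (n : ℕ) (π : Representation ℂ (soEvenSplit k n).group V), (soEvenSplit k n).IsUnramified π →
      (soEvenSplit k n).IsUnramified (conjRep σ π) ∧
      ∀ Pi : Representation ℂ (gl k (2 * n)).group W,
        transferSOEvenSplit k n π Pi ↔
          transferSOEvenSplit k n (conjRep σ π)
            (twist (absDet k (2 * n) (1 / 2))
              (conjRep σ (twist (absDet k (2 * n) (-(1 / 2))) Pi)))) ∧
    (∀ (n : ℕ) (a b : k) (π : Representation ℂ (soEvenNonsplit k n a b).group V),
      (soEvenNonsplit k n a b).IsUnramified π →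
      (soEvenNonsplit k n a b).IsUnramified (conjRep σ π) ∧
      ∀ Pi : Representation ℂ (gl k (2 * n)).group W,
        transferSOEvenNonsplit k n a b π Pi ↔
          transferSOEvenNonsplit k n a b (conjRep σ π)
            (twist (absDet k (2 * n) (1 / 2))
              (conjRep σ (twist (absDet k (2 * n) (-(1 / 2))) Pi)))) :=
  ⟨fun n π hπ => ⟨hπ.conjRep σ, transferSOOdd_conjRep_iff σ n π⟩,
    fun n π hπ => ⟨hπ.conjRep σ, transferSp_conjRep_iff σ n π⟩,
    fun _ _ _ _ _ _ _ _ hfin hcard hc n π hπ =>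
      ⟨hπ.conjRep σ, transferUnitary_conjRep_iff σ hfin hcard hc n π⟩,
    fun n π hπ => ⟨hπ.conjRep σ, transferSOEvenSplit_conjRep_iff σ n π⟩,
    fun n a b π hπ => ⟨hπ.conjRep σ, transferSOEvenNonsplit_conjRep_iff σ n a b π⟩⟩

theorem lemma9p2 {k : Type*} [Field k] [CharZero k] [ValuativeRel k] [TopologicalSpace k]
    [IsNonarchimedeanLocalField k] (σ : ℂ ≃+* ℂ)
    {V : Type*} [AddCommGroup V] [Module ℂ V] {W : Type*} [AddCommGroup W] [Module ℂ W] :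
    -- (i) `SO(2n+1)`
    (∀ (n : ℕ) (π : Representation ℂ (soOdd k n).group V), (soOdd k n).IsUnramified π →
      (soOdd k n).IsUnramified (conjRep σ π) ∧
      ∀ Pi : Representation ℂ (gl k (2 * n)).group W,
        transferSOOdd k n π Pi ↔ transferSOOdd k n (conjRep σ π) (conjRep σ Pi)) ∧
    -- (i) `Sp(2n)`
    (∀ (n : ℕ) (π : Representation ℂ (sp k n).group V), (sp k n).IsUnramified π →
      (sp k n).IsUnramified (conjRep σ π) ∧
      ∀ Pi : Representation ℂ (gl k (2 * n + 1)).group W,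
        transferSp k n π Pi ↔ transferSp k n (conjRep σ π) (conjRep σ Pi)) ∧
    -- (i) `U(n)`, for the unramified quadratic extension `E` of `k`
    (∀ (E : Type*) [Field E] [ValuativeRel E] [TopologicalSpace E] [IsNonarchimedeanLocalField E]
      [Algebra k E] [ValuativeExtension k E] (c : E ≃ₐ[k] E),
      Module.finrank k E = 2 → Nat.card 𝓀[E] = Nat.card 𝓀[k] ^ 2 → c ≠ AlgEquiv.refl →
      ∀ (n : ℕ) (π : Representation ℂ (unitaryU c n).group V), (unitaryU c n).IsUnramified π →
      (unitaryU c n).IsUnramified (conjRep σ π) ∧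
      ∀ Pi : Representation ℂ (gl E n).group W,
        transferUnitary c n π Pi ↔ transferUnitary c n (conjRep σ π) (conjRep σ Pi)) ∧
    -- (ii) split `SO(2n)`
    (∀ (n : ℕ) (π : Representation ℂ (soEvenSplit k n).group V), (soEvenSplit k n).IsUnramified π →
      (soEvenSplit k n).IsUnramified (conjRep σ π) ∧
      ∀ Pi : Representation ℂ (gl k (2 * n)).group W,
        transferSOEvenSplit k n π Pi ↔
          transferSOEvenSplit k n (conjRep σ π)
            (twist (absDet k (2 * n) (1 / 2))
              (conjRep σ (twist (absDet k (2 * n) (-(1 / 2))) Pi)))) ∧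
    -- (ii) nonsplit `SO(2n)`, split by the unramified quadratic extension of `k`
    (∀ (n : ℕ) (a b : 𝒪[k]),
      Irreducible (Polynomial.X ^ 2 + Polynomial.C (IsLocalRing.residue 𝒪[k] a) * Polynomial.X +
        Polynomial.C (IsLocalRing.residue 𝒪[k] b)) →
      ∀ π : Representation ℂ (soEvenNonsplit k n a.val b.val).group V,
      (soEvenNonsplit k n a.val b.val).IsUnramified π →
      (soEvenNonsplit k n a.val b.val).IsUnramified (conjRep σ π) ∧
      ∀ Pi : Representation ℂ (gl k (2 * n)).group W,
        transferSOEvenNonsplit k n a.val b.val π Pi ↔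
          transferSOEvenNonsplit k n a.val b.val (conjRep σ π)
            (twist (absDet k (2 * n) (1 / 2))
              (conjRep σ (twist (absDet k (2 * n) (-(1 / 2))) Pi)))) :=
  let ⟨soOdd, sp, unitary, soEvenSplit, soEvenNonsplit⟩ := lemma9p2_general σ
  ⟨soOdd, sp, unitary, soEvenSplit, fun n a b _ => soEvenNonsplit n a.val b.val⟩
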